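/- Let $z,z',w,w'$ be complex parameters which are \emph{admissible}, i.e. for every integer $k$ the numbers $(z+k)(z'+k)$ and $(w+k)(w'+k)$ are real and strictly positive, and $\Re(z+z'+w+w')>-1$. Let $N\in\{1,2,\dots\}$, let $\Omega_N\subset\mathbb Z^N$ be the (discrete) set of $N$-tuples $\mathbf n=(n_1>\dots>n_N)$ of integers, let $V(\mathbf n)=\prod_{1\le i<j\le N}(n_i-n_j)$, and let $\varepsilon_1,\dots,\varepsilon_N$ be the canonical basis of $\mathbb Z^N$. For $f:\Omega_N\to\mathbb R$ set $$ (D_{z,z',w,w'|N}f)(\mathbf n)=\sum_{k=1}^N\Big(\tfrac{V(\mathbf n+\varepsilon_k)}{V(\mathbf n)}(z+N-1-n_k)(z'+N-1-n_k)\big(f(\mathbf n+\varepsilon_k)-f(\mathbf n)\big)+\tfrac{V(\mathbf n-\varepsilon_k)}{V(\mathbf n)}(w+n_k)(w'+n_k)\big(f(\mathbf n-\varepsilon_k)-f(\mathbf n)\big)\Big), $$ where terms with $\mathbf n\pm\varepsilon_k\notin\Omega_N$ are understood to be $0$ (their coefficient $V(\mathbf n\pm\varepsilon_k)$ vanishes).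 Let $C_0(\Omega_N)$ be the Banach space of real-valued functions on $\Omega_N$ vanishing at infinity, with the supremum norm. A \emph{Feller semigroup} on $\Omega_N$ is a strongly continuous one-parameter semigroup $P(t)$, $t\ge0$ (with $P(0)=1$), of operators on $C_0(\Omega_N)$ given by Markov kernels: $(P(t)f)(x)=\int P(t;x,dy)f(y)$ with $P(t;x,\cdot)$ a probability measure on $\Omega_N$ for all $t\ge 0$ and $x\in\Omega_N$. Its \emph{generator} is the operator $Af=\lim_{t\to+0}(P(t)f-f)/t$ whose domain consists of all $f\in C_0(\Omega_N)$ for which this limit exists in $C_0(\Omega_N)$. \textbf{Theorem.} For every admissible quadruple $(z,z',w,w')$ and every $N=1,2,\dots$ there exists a Feller semigroup on $\Omega_N$ whose generator is the operator $f\mapsto D_{z,z',w,w'|N}f$ with domain $$ \{f\in C_0(\Omega_N): D_{z,z',w,w'|N}f\in C_0(\Omega_N)\}. $$ -/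

import Mathlib

open Filter Topology MeasureTheory ProbabilityTheory
open scoped NNReal ZeroAtInfty

noncomputable section

namespace FellerZW

/-! ### Feller semigroups and their generators -/

section Semigroup

variable {X : Type*} [TopologicalSpace X]

/-- A Feller semigroup on `X`: a strongly continuous one-parameter semigroup of bounded operators
on the Banach space `C₀(X, ℝ)` (supremum norm) which are given by Markov kernels on `X`, i.e.
`(P t f)(x) = ∫ P(t; x, dy) f(y)` with `P(t; x, ·)` a probability measure. -/
structure IsFellerSemigroup [MeasurableSpace X]
    (P : ℝ≥0 → (C₀(X, ℝ) →L[ℝ] C₀(X, ℝ))) : Prop where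
  zero : P 0 = ContinuousLinearMap.id ℝ C₀(X, ℝ)
  add : ∀ s t : ℝ≥0, P (s + t) = (P s).comp (P t)
  strongly_continuous : ∀ f : C₀(X, ℝ), Continuous (fun t : ℝ≥0 => P t f)
  markov : ∀ t : ℝ≥0, ∃ κ : Kernel X X, IsMarkovKernel κ ∧
    ∀ (f : C₀(X, ℝ)) (x : X), P t f x = ∫ y, f y ∂(κ x)

/-- `g = lim_{t → 0+} (P t f - f) / t`, the limit being taken in the norm of `C₀(X, ℝ)`. -/
def IsGeneratorValue (P : ℝ≥0 → (C₀(X, ℝ) →L[ℝ] C₀(X, ℝ))) (f g : C₀(X, ℝ)) : Prop :=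
  Tendsto (fun t : ℝ≥0 => (t : ℝ)⁻¹ • (P t f - f)) (𝓝[>] (0 : ℝ≥0)) (𝓝 g)

theorem IsGeneratorValue.unique {P : ℝ≥0 → (C₀(X, ℝ) →L[ℝ] C₀(X, ℝ))} {f g g' : C₀(X, ℝ)}
    (h : IsGeneratorValue P f g) (h' : IsGeneratorValue P f g') : g = g' :=
  tendsto_nhds_unique h h'

theorem IsGeneratorValue.add {P : ℝ≥0 → (C₀(X, ℝ) →L[ℝ] C₀(X, ℝ))} {f g f' g' : C₀(X, ℝ)}
    (h : IsGeneratorValue P f g) (h' : IsGeneratorValue P f' g') :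
    IsGeneratorValue P (f + f') (g + g') := by
  refine (Tendsto.add h h').congr fun t => ?_
  rw [map_add]
  ext x
  simp only [ZeroAtInftyContinuousMap.coe_add, ZeroAtInftyContinuousMap.coe_smul,
    ZeroAtInftyContinuousMap.coe_sub, Pi.add_apply, Pi.smul_apply, Pi.sub_apply, smul_eq_mul]
  ring

theorem IsGeneratorValue.smul {P : ℝ≥0 → (C₀(X, ℝ) →L[ℝ] C₀(X, ℝ))} {f g : C₀(X, ℝ)} (c : ℝ)
    (h : IsGeneratorValue P f g) : IsGeneratorValue P (c • f) (c • g) := by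
  refine (Tendsto.const_smul h c).congr fun t => ?_
  rw [map_smul]
  ext x
  simp only [ZeroAtInftyContinuousMap.coe_smul,
    ZeroAtInftyContinuousMap.coe_sub, Pi.smul_apply, Pi.sub_apply, smul_eq_mul]
  ring

theorem IsGeneratorValue.zero (P : ℝ≥0 → (C₀(X, ℝ) →L[ℝ] C₀(X, ℝ))) :
    IsGeneratorValue P 0 0 := by
  simp [IsGeneratorValue]

/-- The infinitesimal generator of `P`, as an unbounded operator on `C₀(X, ℝ)`: its domain consists
of all `f` for which `lim_{t → 0+} (P t f - f) / t` exists, and its value at `f` is that limit. -/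
def generator (P : ℝ≥0 → (C₀(X, ℝ) →L[ℝ] C₀(X, ℝ))) : C₀(X, ℝ) →ₗ.[ℝ] C₀(X, ℝ) where
  domain :=
    { carrier := {f | ∃ g, IsGeneratorValue P f g}
      add_mem' := fun ⟨_, h⟩ ⟨_, h'⟩ => ⟨_, h.add h'⟩
      zero_mem' := ⟨0, IsGeneratorValue.zero P⟩
      smul_mem' := fun c _ ⟨_, h⟩ => ⟨_, h.smul c⟩ }
  toFun :=
    { toFun := fun f => Classical.choose f.2
      map_add' := fun f f' => (Classical.choose_spec (f + f').2).unique
        ((Classical.choose_spec f.2).add (Classical.choose_spec f'.2))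
      map_smul' := fun c f => (Classical.choose_spec (c • f).2).unique
        ((Classical.choose_spec f.2).smul c) }

/-- The maximal operator on `C₀(X, ℝ)` attached to a linear operator `D` on functions on `X`:
its domain is `{f ∈ C₀(X) : D f ∈ C₀(X)}`, and it acts on this domain as `D`. -/
def maximalOperator (D : (X → ℝ) →ₗ[ℝ] (X → ℝ)) : C₀(X, ℝ) →ₗ.[ℝ] C₀(X, ℝ) where
  domain :=
    { carrier := {f | ∃ g : C₀(X, ℝ), (g : X → ℝ) = D f}
      add_mem' := fun {f f'} ⟨g, h⟩ ⟨g', h'⟩ => ⟨g + g', by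
        rw [ZeroAtInftyContinuousMap.coe_add, ZeroAtInftyContinuousMap.coe_add, map_add, h, h']⟩
      zero_mem' := ⟨0, by simp⟩
      smul_mem' := fun c f ⟨g, h⟩ => ⟨c • g, by
        rw [ZeroAtInftyContinuousMap.coe_smul, ZeroAtInftyContinuousMap.coe_smul, map_smul, h]⟩ }
  toFun :=
    { toFun := fun f => Classical.choose f.2
      map_add' := fun f f' => DFunLike.coe_injective <| by
        rw [Classical.choose_spec (f + f').2, ZeroAtInftyContinuousMap.coe_add,
          Classical.choose_spec f.2, Classical.choose_spec f'.2, ← map_add]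
        rfl
      map_smul' := fun c f => DFunLike.coe_injective <| by
        rw [Classical.choose_spec (c • f).2, RingHom.id_apply, ZeroAtInftyContinuousMap.coe_smul,
          Classical.choose_spec f.2, ← map_smul]
        rfl }

end Semigroup

/-! ### The difference operator -/

/-- Admissible quadruples of complex parameters. "`> 0`" for a complex number means that it is
real and positive. -/
structure Admissible (z z' w w' : ℂ) : Prop where
  z_pos : ∀ k : ℤ, 0 < ((z + k) * (z' + k)).re ∧ ((z + k) * (z' + k)).im = 0
  w_pos : ∀ k : ℤ, 0 < ((w + k) * (w' + k)).re ∧ ((w + k) * (w' + k)).im = 0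
  sum_re : -1 < (z + z' + w + w').re

/-- The set `Ω_N ⊂ ℤ^N` of strictly decreasing `N`-tuples of integers, with the (discrete)
topology and the Borel structure inherited from `ℤ^N`. -/
abbrev Omega (N : ℕ) : Type := {n : Fin N → ℤ // StrictAnti n}

/-- The Vandermonde product `V(n) = ∏_{i < j} (n_i - n_j)`. -/
def vandermonde {N : ℕ} (n : Fin N → ℤ) : ℝ :=
  ∏ i : Fin N, ∏ j ∈ Finset.Ioi i, ((n i : ℝ) - (n j : ℝ))

open scoped Classical in
/-- The value of `f : Ω_N → ℝ` at a point of `ℤ^N`, set to be `0` outside `Ω_N`.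
In the difference operator, the points outside `Ω_N` only occur with the coefficient `0`. -/
def valueAt {N : ℕ} (f : Omega N → ℝ) (m : Fin N → ℤ) : ℝ :=
  if h : StrictAnti m then f ⟨m, h⟩ else 0

/-- The coefficient of `f(n + ε_k) - f(n)`. The product of the two complex factors is real for
admissible parameters. -/
def upRate {N : ℕ} (z z' : ℂ) (n : Omega N) (k : Fin N) : ℝ :=
  vandermonde (n.1 + Pi.single k 1) / vandermonde n.1 *
    ((z + N - 1 - n.1 k) * (z' + N - 1 - n.1 k)).re

/-- The coefficient of `f(n - ε_k) - f(n)`. The product of the two complex factors is real for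
admissible parameters. -/
def downRate {N : ℕ} (w w' : ℂ) (n : Omega N) (k : Fin N) : ℝ :=
  vandermonde (n.1 - Pi.single k 1) / vandermonde n.1 *
    ((w + n.1 k) * (w' + n.1 k)).re

theorem valueAt_add {N : ℕ} (f g : Omega N → ℝ) (m : Fin N → ℤ) :
    valueAt (f + g) m = valueAt f m + valueAt g m := by
  unfold valueAt
  split_ifs <;> simp

theorem valueAt_smul {N : ℕ} (c : ℝ) (f : Omega N → ℝ) (m : Fin N → ℤ) :
    valueAt (c • f) m = c * valueAt f m := by
  unfold valueAt
  split_ifs <;> simp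

/-- The partial difference operator `D_{z,z',w,w'|N}` on functions on `Ω_N`. In this form, with
differences `f(n ± ε_k) - f(n)`, it annihilates the constants, so no constant term is needed. -/
def diffOp (N : ℕ) (z z' w w' : ℂ) : (Omega N → ℝ) →ₗ[ℝ] (Omega N → ℝ) where
  toFun f n := ∑ k : Fin N,
    (upRate z z' n k * (valueAt f (n.1 + Pi.single k 1) - f n) +
      downRate w w' n k * (valueAt f (n.1 - Pi.single k 1) - f n))
  map_add' f g := by
    funext n
    simp only [valueAt_add, Pi.add_apply, ← Finset.sum_add_distrib]
    exact Finset.sum_congr rfl fun k _ => by ring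
  map_smul' c f := by
    funext n
    simp only [valueAt_smul, Pi.smul_apply, smul_eq_mul, RingHom.id_apply, Finset.mul_sum]
    exact Finset.sum_congr rfl fun k _ => by ring

end FellerZW

end

/-! ### Exponentials of bounded operators -/

namespace HilleYosida

variable {E : Type*} [NormedAddCommGroup E] [NormedSpace ℝ E]

/-! The operator is that of a continuous-time jump process with nonnegative rates and finitely many
jumps from each state. The rates grow quadratically, so non-explosion and decay of the resolvent at
infinity must come from a Lyapunov function: φ = log ψ with ψ(n) = 1 + ∑ n_k².

Put Γf(x) = ∑ q(x,i) (f(σ(x,i)) - f(x))². If |Dφ| and Γφ are bounded by C, then b_ε = 1/(1 + εφ)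
lies in C₀, tends to 1 pointwise as ε → 0, and satisfies |D b_ε| ≤ 2Cε b_ε². With ε = 1 it is a
supersolution which forces the minimal solution of c f - D f = g, for c > 2C, to vanish at infinity
(`exists_solution`). The maximum principle gives dissipativity, point masses give density, and
Hille–Yosida (`HilleYosida.exists_semigroup`) yields a contraction semigroup generated by the
maximal operator. As ε → 0 the b_ε show that no mass is lost; together with contractivity this also
gives positivity, hence Markov kernels.

The bounds on φ follow from |Dψ| ≤ Cψ and Γψ ≤ Cψ². The second is a crude count of degrees. In the
first, Dψ looks cubic in n. Expanding the Vandermonde ratios turns it into divided differences of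
monomials, which are polynomials in the nodes, and the cubic parts of the upward and downward jumps
cancel (`abs_shiftSum_sub_le`). -/

theorem norm_pow_apply_le (B : E →L[ℝ] E) (n : ℕ) (f : E) : ‖(B ^ n) f‖ ≤ ‖B‖ ^ n * ‖f‖ := by
  induction n with
  | zero => simp
  | succ n ih =>
    rw [pow_succ', mul_apply_eq_comp, pow_succ', mul_assoc]
    exact (B.le_opNorm _).trans (mul_le_mul_of_nonneg_left ih (norm_nonneg _))

theorem exp_smul_commute_self {B C : E →L[ℝ] E} (h : Commute B C) (t : ℝ) :
    Commute B (NormedSpace.exp (t • C)) :=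
  let : NormedAlgebra ℚ (E →L[ℝ] E) := NormedAlgebra.restrictScalars ℚ ℝ _
  (h.smul_right t).exp_right

variable [CompleteSpace E]

theorem norm_exp_apply_le (B : E →L[ℝ] E) (f : E) :
    ‖NormedSpace.exp B f‖ ≤ Real.exp ‖B‖ * ‖f‖ := by
  have h1 : HasSum (fun n : ℕ => ((n.factorial : ℝ)⁻¹ • B ^ n) f) (NormedSpace.exp B f) :=
    (NormedSpace.exp_series_hasSum_exp' (𝕂 := ℝ) B).mapL (ContinuousLinearMap.apply ℝ E f)
  have h2 : HasSum (fun n : ℕ => ((n.factorial : ℝ)⁻¹ • ‖B‖ ^ n) * ‖f‖)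
      (Real.exp ‖B‖ * ‖f‖) := by
    rw [Real.exp_eq_exp_ℝ]
    exact (NormedSpace.exp_series_hasSum_exp' (𝕂 := ℝ) ‖B‖).mul_right _
  refine h1.norm_le_of_bounded h2 fun n => ?_
  rw [smul_apply, norm_smul, smul_eq_mul, mul_assoc, Real.norm_of_nonneg
    (by positivity)]
  exact mul_le_mul_of_nonneg_left (norm_pow_apply_le B n f) (by positivity)

/-- The Yosida approximation `c² R - c` generates a contraction semigroup if `c ‖R‖ ≤ 1`. -/
theorem norm_exp_yosida_apply_le {R : E →L[ℝ] E} {c : ℝ} (hc : 0 < c)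
    (hR : ∀ f, c * ‖R f‖ ≤ ‖f‖) {t : ℝ} (ht : 0 ≤ t) (f : E) :
    ‖NormedSpace.exp (t • (c ^ 2 • R - c • (1 : E →L[ℝ] E))) f‖ ≤ ‖f‖ := by
  let : NormedAlgebra ℚ (E →L[ℝ] E) := NormedAlgebra.restrictScalars ℚ ℝ _
  have hR' : ‖R‖ ≤ c⁻¹ := R.opNorm_le_bound (by positivity) fun g => by
    have := hR g
    rw [inv_mul_eq_div, le_div_iff₀ hc]
    linarith
  -- The scalar part contributes exp(-tc), which exactly compensates ‖exp(tc²R)‖ ≤ exp(tc).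
  have hsplit : t • (c ^ 2 • R - c • (1 : E →L[ℝ] E))
      = algebraMap ℝ (E →L[ℝ] E) (-(t * c)) + (t * c ^ 2) • R := by
    rw [Algebra.algebraMap_eq_smul_one]
    module
  rw [hsplit, NormedSpace.exp_add_of_commute (Algebra.commutes _ _),
    ← NormedSpace.algebraMap_exp_comm, mul_apply_eq_comp, ← Real.exp_eq_exp_ℝ,
    Algebra.algebraMap_eq_smul_one, smul_apply, one_apply_eq_self,
    norm_smul, Real.norm_of_nonneg (Real.exp_nonneg _)]
  calc Real.exp (-(t * c)) * ‖NormedSpace.exp ((t * c ^ 2) • R) f‖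
      ≤ Real.exp (-(t * c)) * (Real.exp ‖(t * c ^ 2) • R‖ * ‖f‖) := by
        gcongr
        exact norm_exp_apply_le _ f
    _ ≤ Real.exp (-(t * c)) * (Real.exp (t * c) * ‖f‖) := by
        gcongr
        rw [norm_smul, Real.norm_of_nonneg (by positivity)]
        calc t * c ^ 2 * ‖R‖ ≤ t * c ^ 2 * c⁻¹ := by gcongr
          _ = t * c := by field_simp
    _ = ‖f‖ := by rw [← mul_assoc, ← Real.exp_add]; simp

theorem exp_add_smul (B : E →L[ℝ] E) (s t : ℝ) :
    NormedSpace.exp ((s + t) • B) = NormedSpace.exp (s • B) * NormedSpace.exp (t • B) := by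
  let : NormedAlgebra ℚ (E →L[ℝ] E) := NormedAlgebra.restrictScalars ℚ ℝ _
  rw [add_smul]
  exact NormedSpace.exp_add_of_commute (((Commute.refl B).smul_left s).smul_right t)

/-- Interpolate by s ↦ exp(sB) exp((t-s)C) f; by commutation the derivative is a contraction applied
to Bf - Cf. This makes the Yosida semigroups a Cauchy sequence on the domain. -/
theorem norm_exp_sub_exp_apply_le {B C : E →L[ℝ] E} (hBC : Commute B C)
    (hB : ∀ t : ℝ, 0 ≤ t → ∀ f, ‖NormedSpace.exp (t • B) f‖ ≤ ‖f‖)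
    (hC : ∀ t : ℝ, 0 ≤ t → ∀ f, ‖NormedSpace.exp (t • C) f‖ ≤ ‖f‖)
    {t : ℝ} (ht : 0 ≤ t) (f : E) :
    ‖NormedSpace.exp (t • B) f - NormedSpace.exp (t • C) f‖ ≤ t * ‖B f - C f‖ := by
  have hd : ∀ s : ℝ, HasDerivAt
      (fun s : ℝ => (NormedSpace.exp (s • B) * NormedSpace.exp ((t - s) • C)) f)
      ((NormedSpace.exp (s • B) * NormedSpace.exp ((t - s) • C)) (B f - C f)) s := by
    intro s
    have h1 := hasDerivAt_exp_smul_const (𝕂 := ℝ) B s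
    have h2 := (hasDerivAt_exp_smul_const (𝕂 := ℝ) C (t - s)).scomp s
      ((hasDerivAt_id s).const_sub t)
    have h3 := (h1.mul h2).clm_apply (hasDerivAt_const s f)
    have hB' := (exp_smul_commute_self hBC (t - s)).eq
    refine h3.congr_deriv ?_
    simp only [map_zero, add_zero, Function.comp_apply, neg_smul, one_smul, mul_neg]
    rw [mul_assoc, hB', map_sub]
    simp [sub_eq_add_neg]
  have := norm_image_sub_le_of_norm_deriv_le_segment' (C := ‖B f - C f‖) (a := 0) (b := t)
    (fun s _ => (hd s).hasDerivWithinAt) (fun s hs => ?_) t ⟨ht, le_rfl⟩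
  · simpa [mul_comm] using this
  · rw [mul_apply_eq_comp]
    exact (hB s hs.1 _).trans (hC (t - s) (by linarith [hs.2]) _)

theorem norm_exp_apply_sub_le {B : E →L[ℝ] E}
    (hB : ∀ t : ℝ, 0 ≤ t → ∀ f, ‖NormedSpace.exp (t • B) f‖ ≤ ‖f‖)
    {t : ℝ} (ht : 0 ≤ t) (f : E) :
    ‖NormedSpace.exp (t • B) f - f‖ ≤ t * ‖B f‖ := by
  simpa using norm_exp_sub_exp_apply_le (Commute.zero_right B) hB
    (fun t _ f => by simp) ht f

/-- Neither ‖B‖ nor B²f enters the bound, so it survives the limit along unbounded Yosida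
approximations. The vector g stands for a domain element near Bf. -/
theorem norm_exp_apply_sub_sub_le {B : E →L[ℝ] E}
    (hB : ∀ t : ℝ, 0 ≤ t → ∀ f, ‖NormedSpace.exp (t • B) f‖ ≤ ‖f‖)
    {t : ℝ} (ht : 0 ≤ t) (f g : E) :
    ‖NormedSpace.exp (t • B) f - f - t • B f‖ ≤ t * (2 * ‖B f - g‖ + t * ‖B g‖) := by
  have hd : ∀ s : ℝ, HasDerivAt (fun s : ℝ => NormedSpace.exp (s • B) f - s • B f)
      (NormedSpace.exp (s • B) (B f) - B f) s := by
    intro s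
    have h1 := (hasDerivAt_exp_smul_const (𝕂 := ℝ) B s).clm_apply (hasDerivAt_const s f)
    have h2 := (hasDerivAt_id s).smul_const (B f)
    refine (h1.sub h2).congr_deriv ?_
    simp
  have := norm_image_sub_le_of_norm_deriv_le_segment' (C := 2 * ‖B f - g‖ + t * ‖B g‖)
    (a := 0) (b := t)
    (fun s _ => (hd s).hasDerivWithinAt) (fun s hs => ?_) t ⟨ht, le_rfl⟩
  · have e : NormedSpace.exp (t • B) f - f - t • B f
        = NormedSpace.exp (t • B) f - t • B f
          - (NormedSpace.exp ((0 : ℝ) • B) f - (0 : ℝ) • B f) := by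
      simp
      abel
    rw [e]
    simpa [mul_comm] using this
  · have e : NormedSpace.exp (s • B) (B f) - B f = NormedSpace.exp (s • B) (B f - g)
        + (NormedSpace.exp (s • B) g - g) + (g - B f) := by
      rw [map_sub]
      abel
    rw [e]
    refine (norm_add₃_le).trans ?_
    have h1 := hB s hs.1 (B f - g)
    have h2 := norm_exp_apply_sub_le hB hs.1 g
    have h3 : s * ‖B g‖ ≤ t * ‖B g‖ := mul_le_mul_of_nonneg_right hs.2.le (norm_nonneg _)
    rw [norm_sub_rev g]
    linarith

end HilleYosida

/-! ### The Hille–Yosida theorem for dissipative operators -/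

namespace HilleYosida

variable {E : Type*} [NormedAddCommGroup E] [NormedSpace ℝ E]

/-- `c ‖f‖ ≤ ‖c f - A f‖` for all `c > 0` and all `f` in the domain of `A`. -/
def Dissipative (A : E →ₗ.[ℝ] E) : Prop :=
  ∀ c : ℝ, 0 < c → ∀ f : A.domain, c * ‖(f : E)‖ ≤ ‖c • (f : E) - A f‖

/-- `R` is a contractive resolvent of `A` at `c`. -/
structure IsResolvent (A : E →ₗ.[ℝ] E) (c : ℝ) (R : E →L[ℝ] E) : Prop where
  left_inv : ∀ f : A.domain, R (c • (f : E) - A f) = f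
  right_inv : ∀ g, ∃ f : A.domain, R g = f ∧ c • (f : E) - A f = g
  norm_le : ∀ g, c * ‖R g‖ ≤ ‖g‖

theorem Dissipative.exists_isResolvent {A : E →ₗ.[ℝ] E} (hA : Dissipative A) {c : ℝ} (hc : 0 < c)
    (hsurj : ∀ g, ∃ f : A.domain, c • (f : E) - A f = g) : ∃ R, IsResolvent A c R := by
  let T : A.domain →ₗ[ℝ] E := c • A.domain.subtype - A.toFun
  have hT : ∀ f : A.domain, T f = c • (f : E) - A f := fun f => rfl
  have hinj : Function.Injective T := by
    rw [injective_iff_map_eq_zero]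
    intro f hf
    have := hA c hc f
    rw [← hT, hf, norm_zero] at this
    have h0 : ‖(f : E)‖ ≤ 0 := by
      by_contra! h
      linarith [mul_pos hc h]
    exact Subtype.ext (norm_le_zero_iff.1 h0)
  let e := LinearEquiv.ofBijective T ⟨hinj, hsurj⟩
  have he : ∀ g, c • ((e.symm g : A.domain) : E) - A (e.symm g) = g := fun g => by
    rw [← hT]
    exact e.apply_symm_apply g
  have hn : ∀ g, c * ‖((e.symm g : A.domain) : E)‖ ≤ ‖g‖ := fun g => by
    simpa only [he g] using hA c hc (e.symm g)
  refine ⟨(A.domain.subtype.comp e.symm.toLinearMap).mkContinuous c⁻¹ fun g => ?_, ?_, ?_, ?_⟩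
  · rw [inv_mul_eq_div, le_div_iff₀ hc, mul_comm]
    exact hn g
  · intro f
    exact congrArg Subtype.val (e.symm_apply_apply f)
  · exact fun g => ⟨e.symm g, rfl, he g⟩
  · exact hn

namespace IsResolvent

variable {A : E →ₗ.[ℝ] E} {c d : ℝ} {R S : E →L[ℝ] E}

theorem sub_apply (hR : IsResolvent A c R) (hS : IsResolvent A d S) (g : E) :
    R g - S g = (d - c) • R (S g) := by
  obtain ⟨f, hf, hg⟩ := hS.right_inv g
  have h := hR.left_inv f
  have h1 : c • (f : E) - A f = g - (d - c) • (f : E) := by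
    rw [← hg]
    module
  rw [h1, map_sub, map_smul] at h
  rw [hf, sub_eq_iff_eq_add, ← sub_eq_iff_eq_add', h]

/-- The resolvent identity read in both orders gives commutation after division by d - c; for c = d
it says instead that the resolvents coincide. -/
theorem commute (hR : IsResolvent A c R) (hS : IsResolvent A d S) : Commute R S := by
  ext g
  simp only [mul_apply_eq_comp]
  rcases eq_or_ne c d with rfl | hcd
  · have h : ∀ g, R g = S g := fun g => by
      have := hR.sub_apply hS g
      rwa [sub_self, zero_smul, sub_eq_zero] at this
    rw [h, h]
  · have h1 := hR.sub_apply hS g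
    have h2 := hS.sub_apply hR g
    have h3 : (d - c) • R (S g) = (d - c) • S (R g) := by
      rw [← h1, ← neg_sub c d, neg_smul, ← h2]
      abel
    exact smul_right_injective E (sub_ne_zero.2 hcd.symm) h3

theorem apply_operator (hR : IsResolvent A c R) (f : A.domain) :
    R (A f) = c • R (f : E) - f := by
  have := hR.left_inv f
  rw [map_sub, map_smul] at this
  rw [eq_sub_iff_add_eq, ← eq_sub_iff_add_eq', this]

end IsResolvent

/-- The Yosida approximation of an operator with resolvent `R` at `c`. -/
def yosida (c : ℝ) (R : E →L[ℝ] E) : E →L[ℝ] E := c ^ 2 • R - c • (1 : E →L[ℝ] E)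

theorem yosida_commute {c d : ℝ} {R S : E →L[ℝ] E} (h : Commute R S) :
    Commute (yosida c R) (yosida d S) := by
  unfold yosida
  refine Commute.sub_left (Commute.sub_right ?_ ?_) (Commute.sub_right ?_ ?_)
  · exact (h.smul_left _).smul_right _
  · exact ((Commute.one_right _).smul_left _).smul_right _
  · exact ((Commute.one_left _).smul_left _).smul_right _
  · exact ((Commute.one_right _).smul_left _).smul_right _

theorem IsResolvent.yosida_apply {A : E →ₗ.[ℝ] E} {c : ℝ} {R : E →L[ℝ] E}
    (hR : IsResolvent A c R) (f : A.domain) : yosida c R f = c • R (A f) := by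
  rw [hR.apply_operator]
  simp only [yosida, _root_.sub_apply, smul_apply, one_apply_eq_self]
  module

/-- Pointwise convergence of contractions to the identity may be checked on a dense set. -/
theorem tendsto_self_of_dense {ι : Type*} {l : Filter ι} {T : ι → E →L[ℝ] E} {S : Set E}
    (hS : Dense S) (hT : ∀ i g, ‖T i g‖ ≤ ‖g‖)
    (h : ∀ f ∈ S, Tendsto (fun i => T i f) l (𝓝 f)) (g : E) :
    Tendsto (fun i => T i g) l (𝓝 g) := by
  rw [Metric.tendsto_nhds]
  intro ε hε
  obtain ⟨f, hf, hgf⟩ := hS.exists_dist_lt g (show 0 < ε / 3 by positivity)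
  filter_upwards [Metric.tendsto_nhds.1 (h f hf) (ε / 3) (by positivity)] with i hi
  have h1 : dist (T i g) (T i f) ≤ dist g f := by
    rw [dist_eq_norm, dist_eq_norm, ← map_sub]
    exact hT i _
  linarith [dist_triangle4_right (T i g) g (T i f) f, dist_triangle (T i g) (T i f) g,
    dist_triangle (T i f) f g, dist_comm f g]

/-- The pointwise Cauchy property of a sequence of contractions may be checked on a dense set. -/
theorem cauchySeq_of_dense {T : ℕ → E →L[ℝ] E} {S : Set E}
    (hS : Dense S) (hT : ∀ i g, ‖T i g‖ ≤ ‖g‖)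
    (h : ∀ f ∈ S, CauchySeq (fun i => T i f)) (g : E) : CauchySeq (fun i => T i g) := by
  rw [Metric.cauchySeq_iff]
  intro ε hε
  obtain ⟨f, hf, hgf⟩ := hS.exists_dist_lt g (show 0 < ε / 3 by positivity)
  obtain ⟨N, hN⟩ := Metric.cauchySeq_iff.1 (h f hf) (ε / 3) (by positivity)
  refine ⟨N, fun m hm n hn => ?_⟩
  have h1 : ∀ i, dist (T i g) (T i f) ≤ dist g f := fun i => by
    rw [dist_eq_norm, dist_eq_norm, ← map_sub]
    exact hT i _
  linarith [h1 m, h1 n, hN m hm n hn, dist_triangle4 (T m g) (T m f) (T n f) (T n g),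
    dist_comm (T n f) (T n g)]

/-! ### Construction of the semigroup from Yosida approximations -/

section Generation

variable {A : E →ₗ.[ℝ] E} {c : ℕ → ℝ} {R : ℕ → E →L[ℝ] E}

/-- On the domain c R f - f = R A f, of norm at most ‖A f‖ / c; density and contractivity extend the
convergence. -/
theorem tendsto_smul_resolvent (hdense : Dense (A.domain : Set E)) (hc : ∀ n, 0 < c n)
    (hlim : Tendsto c atTop atTop) (hR : ∀ n, IsResolvent A (c n) (R n)) (g : E) :
    Tendsto (fun n => c n • R n g) atTop (𝓝 g) := by
  refine tendsto_self_of_dense (T := fun n => c n • R n) hdense (fun n g => ?_) (fun f hf => ?_) g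
  · rw [smul_apply, norm_smul, Real.norm_of_nonneg (hc n).le]
    exact (hR n).norm_le g
  · rw [tendsto_iff_norm_sub_tendsto_zero]
    refine squeeze_zero (g := fun n => (c n)⁻¹ * ‖A ⟨f, hf⟩‖) (fun _ => norm_nonneg _)
      (fun n => ?_) (by simpa using (tendsto_inv_atTop_zero.comp hlim).mul_const ‖A ⟨f, hf⟩‖)
    have := (hR n).apply_operator ⟨f, hf⟩
    rw [smul_apply, ← this, inv_mul_eq_div, le_div_iff₀ (hc n), mul_comm]
    exact (hR n).norm_le _

theorem tendsto_yosida (hdense : Dense (A.domain : Set E)) (hc : ∀ n, 0 < c n)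
    (hlim : Tendsto c atTop atTop) (hR : ∀ n, IsResolvent A (c n) (R n)) (f : A.domain) :
    Tendsto (fun n => yosida (c n) (R n) f) atTop (𝓝 (A f)) := by
  simp_rw [fun n => (hR n).yosida_apply f]
  exact tendsto_smul_resolvent hdense hc hlim hR _

/-- The generator of a contraction semigroup has no positive eigenvalue. -/
theorem eq_zero_of_tendsto_smul {P : ℝ≥0 → E →L[ℝ] E} (hP : ∀ t f, ‖P t f‖ ≤ ‖f‖) {f : E} {c : ℝ}
    (hc : 0 < c)
    (h : Tendsto (fun t : ℝ≥0 => (t : ℝ)⁻¹ • (P t f - f)) (𝓝[>] 0) (𝓝 (c • f))) : f = 0 := by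
  have h1 : Tendsto (fun t : ℝ≥0 => ‖c • f - (t : ℝ)⁻¹ • (P t f - f)‖) (𝓝[>] 0) (𝓝 0) := by
    simpa using (h.const_sub (c • f)).norm
  have h2 : c * ‖f‖ ≤ 0 := by
    refine ge_of_tendsto h1 ?_
    filter_upwards [self_mem_nhdsWithin] with t ht
    have ht : (0 : ℝ) < t := ht
    -- Contractivity turns this into (c + 1/t)‖f‖ ≤ o(1) + ‖f‖/t, where 1/t cancels.
    have e : (c + (t : ℝ)⁻¹) • f = (c • f - (t : ℝ)⁻¹ • (P t f - f)) + (t : ℝ)⁻¹ • P t f := by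
      module
    have h3 := norm_add_le (c • f - (t : ℝ)⁻¹ • (P t f - f)) ((t : ℝ)⁻¹ • P t f)
    rw [← e, norm_smul, norm_smul, Real.norm_of_nonneg (by positivity),
      Real.norm_of_nonneg (by positivity)] at h3
    have h4 := mul_le_mul_of_nonneg_left (hP t f) (inv_nonneg.2 ht.le)
    linarith
  have h0 : ‖f‖ ≤ 0 := by
    by_contra! h
    linarith [mul_pos hc h]
  exact norm_le_zero_iff.1 h0

variable [CompleteSpace E]

theorem exists_tendsto_exp_yosida (hdense : Dense (A.domain : Set E)) (hc : ∀ n, 0 < c n)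
    (hlim : Tendsto c atTop atTop) (hR : ∀ n, IsResolvent A (c n) (R n)) (t : ℝ≥0) :
    ∃ P : E →L[ℝ] E, ∀ f, Tendsto
      (fun n => NormedSpace.exp ((t : ℝ) • yosida (c n) (R n)) f) atTop (𝓝 (P f)) := by
  have hcontr : ∀ n, ∀ t : ℝ, 0 ≤ t → ∀ f : E,
      ‖NormedSpace.exp (t • yosida (c n) (R n)) f‖ ≤ ‖f‖ := fun n t ht f =>
    norm_exp_yosida_apply_le (hc n) (hR n).norm_le ht f
  have hcauchy : ∀ f, CauchySeq fun n => NormedSpace.exp ((t : ℝ) • yosida (c n) (R n)) f := by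
    refine cauchySeq_of_dense hdense (fun n => hcontr n t t.2) fun f hf => ?_
    have h1 := ((tendsto_yosida hdense hc hlim hR ⟨f, hf⟩).const_smul (t : ℝ)).cauchySeq
    rw [cauchySeq_iff_tendsto_dist_atTop_0] at h1 ⊢
    refine squeeze_zero (fun _ => dist_nonneg) (fun p => ?_) h1
    rw [dist_eq_norm, dist_eq_norm]
    refine (norm_exp_sub_exp_apply_le (yosida_commute ((hR _).commute (hR _)))
      (hcontr _) (hcontr _) t.2 f).trans ?_
    rw [← smul_sub, norm_smul, Real.norm_of_nonneg t.coe_nonneg]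
    exact le_rfl
  choose P hP using fun f => cauchySeq_tendsto_of_complete (hcauchy f)
  exact ⟨continuousLinearMapOfTendsto _ (tendsto_pi_nhds.2 hP), hP⟩

/-- **Hille–Yosida theorem**: a densely defined dissipative operator `A` such that `c - A` is
onto for all large `c` generates a strongly continuous contraction semigroup. -/
theorem exists_semigroup (hdense : Dense (A.domain : Set E)) (hdiss : Dissipative A) {c₀ : ℝ}
    (hsurj : ∀ c, c₀ < c → ∀ g, ∃ f : A.domain, c • (f : E) - A f = g) :
    ∃ P : ℝ≥0 → E →L[ℝ] E, P 0 = ContinuousLinearMap.id ℝ E ∧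
      (∀ s t, P (s + t) = (P s).comp (P t)) ∧ (∀ t f, ‖P t f‖ ≤ ‖f‖) ∧
      (∀ f, Continuous fun t => P t f) ∧ (∀ t (f : A.domain), ‖P t f - f‖ ≤ t * ‖A f‖) ∧
      ∀ f g, Tendsto (fun t : ℝ≥0 => (t : ℝ)⁻¹ • (P t f - f)) (𝓝[>] 0) (𝓝 g) ↔
        ∃ h : f ∈ A.domain, A ⟨f, h⟩ = g := by
  let c : ℕ → ℝ := fun n => max c₀ 0 + 1 + n
  have hc : ∀ n, 0 < c n := fun n => by positivity
  have hc' : ∀ n, c₀ < c n := fun n => by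
    have : (0 : ℝ) ≤ n := n.cast_nonneg
    have := le_max_left c₀ 0
    simp only [c]
    linarith
  have hlim : Tendsto c atTop atTop :=
    tendsto_atTop_add_const_left _ _ tendsto_natCast_atTop_atTop
  choose R hR using fun n => hdiss.exists_isResolvent (hc n) (hsurj (c n) (hc' n))
  have hcontr : ∀ n, ∀ t : ℝ, 0 ≤ t → ∀ f : E,
      ‖NormedSpace.exp (t • yosida (c n) (R n)) f‖ ≤ ‖f‖ := fun n t ht f =>
    norm_exp_yosida_apply_le (hc n) (hR n).norm_le ht f
  choose P hP using exists_tendsto_exp_yosida hdense hc hlim hR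
  have hPcontr : ∀ t f, ‖P t f‖ ≤ ‖f‖ := fun t f =>
    le_of_tendsto (hP t f).norm (Eventually.of_forall fun n => hcontr n t t.2 f)
  have hPlip : ∀ t (f : A.domain), ‖P t f - f‖ ≤ t * ‖A f‖ := fun t f =>
    le_of_tendsto_of_tendsto' ((hP t f).sub_const _).norm
      ((tendsto_yosida hdense hc hlim hR f).norm.const_mul _)
      fun n => norm_exp_apply_sub_le (hcontr n) t.2 _
  have hPadd : ∀ s t, P (s + t) = (P s).comp (P t) := by
    intro s t
    ext f
    refine tendsto_nhds_unique (hP (s + t) f) ?_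
    simp only [NNReal.coe_add, exp_add_smul, mul_apply_eq_comp, ContinuousLinearMap.comp_apply]
    rw [tendsto_iff_norm_sub_tendsto_zero]
    have h1 := ((tendsto_iff_norm_sub_tendsto_zero.1 (hP t f)).add
      (tendsto_iff_norm_sub_tendsto_zero.1 (hP s (P t f))))
    rw [add_zero] at h1
    refine squeeze_zero (fun _ => norm_nonneg _) (fun n => ?_) h1
    refine (norm_sub_le_norm_sub_add_norm_sub _
      (NormedSpace.exp ((s : ℝ) • yosida (c n) (R n)) (P t f)) _).trans ?_
    gcongr
    rw [← map_sub]
    exact hcontr n s s.2 _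
  have hPzero : P 0 = ContinuousLinearMap.id ℝ E := by
    ext f
    refine tendsto_nhds_unique (hP 0 f) ?_
    simp
  have hgen : ∀ f : A.domain,
      Tendsto (fun t : ℝ≥0 => (t : ℝ)⁻¹ • (P t f - f)) (𝓝[>] 0) (𝓝 (A f)) := by
    intro f
    have key : ∀ (t : ℝ≥0) (g : A.domain),
        ‖P t f - f - (t : ℝ) • A f‖ ≤ t * (2 * ‖A f - g‖ + t * ‖A g‖) := fun t g =>
      le_of_tendsto_of_tendsto'
        (((hP t f).sub_const _).sub ((tendsto_yosida hdense hc hlim hR f).const_smul _)).norm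
        ((((((tendsto_yosida hdense hc hlim hR f).sub_const _).norm.const_mul 2).add
          ((tendsto_yosida hdense hc hlim hR g).norm.const_mul _))).const_mul _)
        fun n => norm_exp_apply_sub_sub_le (hcontr n) t.2 _ _
    rw [Metric.tendsto_nhds]
    intro ε hε
    -- `A f` itself need not lie in the domain, so a nearby domain element replaces it.
    obtain ⟨g, hg, hfg⟩ := hdense.exists_dist_lt (A f) (show 0 < ε / 4 by positivity)
    have hsmall : ∀ᶠ t : ℝ≥0 in 𝓝[>] 0, (t : ℝ) * ‖A ⟨g, hg⟩‖ < ε / 2 := by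
      have : Tendsto (fun t : ℝ≥0 => (t : ℝ) * ‖A ⟨g, hg⟩‖) (𝓝 0) (𝓝 0) := by
        have : Continuous (fun t : ℝ≥0 => (t : ℝ) * ‖A ⟨g, hg⟩‖) := by fun_prop
        simpa using this.tendsto 0
      exact (this.mono_left nhdsWithin_le_nhds).eventually (gt_mem_nhds (by positivity))
    filter_upwards [hsmall, self_mem_nhdsWithin] with t ht ht0
    have ht0 : (0 : ℝ) < t := ht0
    have e : (t : ℝ)⁻¹ • (P t f - f) - A f = (t : ℝ)⁻¹ • (P t f - f - (t : ℝ) • A f) := by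
      rw [smul_sub _ _ ((t : ℝ) • A f), smul_smul, inv_mul_cancel₀ ht0.ne', one_smul]
    rw [dist_eq_norm, e, norm_smul, Real.norm_of_nonneg (by positivity), inv_mul_eq_div,
      div_lt_iff₀ ht0]
    refine (key t ⟨g, hg⟩).trans_lt ?_
    rw [mul_comm]
    refine mul_lt_mul_of_pos_right ?_ ht0
    rw [dist_eq_norm] at hfg
    linarith
  refine ⟨P, hPzero, hPadd, hPcontr, fun f => ?_, hPlip, fun f g => ⟨fun h => ?_, ?_⟩⟩
  · have h0 : ∀ f, Tendsto (fun t => P t f) (𝓝 0) (𝓝 f) := by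
      refine tendsto_self_of_dense hdense hPcontr fun f hf => ?_
      rw [tendsto_iff_norm_sub_tendsto_zero]
      refine squeeze_zero (fun _ => norm_nonneg _) (fun t => hPlip t ⟨f, hf⟩) ?_
      have : Continuous (fun t : ℝ≥0 => (t : ℝ) * ‖A ⟨f, hf⟩‖) := by fun_prop
      simpa using this.tendsto 0
    have hmono : ∀ (s u : ℝ≥0), ‖P (s + u) f - P s f‖ ≤ ‖P u f - f‖ := fun s u => by
      rw [hPadd, ContinuousLinearMap.comp_apply, ← map_sub]
      exact hPcontr _ _
    rw [Metric.continuous_iff]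
    intro s ε hε
    obtain ⟨δ, hδ, H⟩ := Metric.tendsto_nhds_nhds.1 (h0 f) ε hε
    refine ⟨δ, hδ, fun t ht => ?_⟩
    have key : ∀ a b : ℝ≥0, a ≤ b → dist b a < δ → dist (P b f) (P a f) < ε := by
      intro a b hab hd
      have h1 := hmono a (b - a)
      rw [add_tsub_cancel_of_le hab] at h1
      rw [dist_eq_norm]
      refine h1.trans_lt ?_
      rw [← dist_eq_norm]
      refine H ?_
      rwa [NNReal.dist_eq, NNReal.coe_zero, sub_zero, NNReal.coe_sub hab, ← NNReal.dist_eq]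
    rcases le_total s t with hst | hst
    · exact key s t hst ht
    · rw [dist_comm] at ht ⊢
      exact key t s hst ht
  -- The generator cannot be larger than A: f' has the same image under c₀ minus the generator as f
  -- (with c₀ = `c 0`), so f - f' would be an eigenvector with positive eigenvalue.
  · obtain ⟨f', hf'⟩ := hsurj (c 0) (hc' 0) (c 0 • f - g)
    have h1 : Tendsto (fun t : ℝ≥0 => (t : ℝ)⁻¹ • (P t (f - f') - (f - f'))) (𝓝[>] 0)
        (𝓝 (c 0 • (f - f'))) := by
      have e : c 0 • (f - f') = g - A f' := by
        rw [sub_eq_sub_iff_add_eq_add] at hf'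
        rw [smul_sub, sub_eq_sub_iff_add_eq_add, hf'.symm, add_comm]
      rw [e]
      refine (h.sub (hgen f')).congr fun t => ?_
      rw [map_sub, ← smul_sub]
      congr 1
      abel
    have h2 : f = f' := sub_eq_zero.1 (eq_zero_of_tendsto_smul hPcontr (hc 0) h1)
    subst h2
    exact ⟨f'.2, sub_right_injective hf'⟩
  · rintro ⟨h, rfl⟩
    exact hgen ⟨f, h⟩

end Generation

end HilleYosida

/-! ### Functions vanishing at infinity on a discrete space -/

namespace DiscreteC0

variable {X : Type*} [TopologicalSpace X]

theorem abs_apply_le_norm (f : C₀(X, ℝ)) (x : X) : |f x| ≤ ‖f‖ :=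
  f.toBCF.norm_coe_le_norm x

theorem norm_le_of_forall {f : C₀(X, ℝ)} {M : ℝ} (hM : 0 ≤ M) (h : ∀ x, |f x| ≤ M) : ‖f‖ ≤ M :=
  (BoundedContinuousFunction.norm_le (f := f.toBCF) hM).2 h

theorem exists_abs_apply_max (f : C₀(X, ℝ)) (hf : f ≠ 0) : ∃ x, f x ≠ 0 ∧ ∀ y, |f y| ≤ |f x| := by
  obtain ⟨x, hx⟩ := DFunLike.ne_iff.1 hf
  have h0 : Tendsto (fun y => |f y|) (cocompact X) (𝓝 0) := by
    simpa using (zero_at_infty f).abs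
  obtain ⟨y, hy⟩ := (f.continuous.abs).exists_forall_ge' x
    ((h0.eventually (gt_mem_nhds (abs_pos.2 hx))).mono fun _ => le_of_lt)
  exact ⟨y, abs_pos.1 ((abs_pos.2 hx).trans_le (hy x)), hy⟩

theorem sum_apply (s : Finset X) (F : X → C₀(X, ℝ)) (x : X) :
    (∑ y ∈ s, F y) x = ∑ y ∈ s, F y x := by
  classical
  induction s using Finset.induction_on with
  | empty => simp
  | insert a s ha ih => simp [Finset.sum_insert ha, ih]

variable [DiscreteTopology X]

theorem finite_le_abs (f : C₀(X, ℝ)) {ε : ℝ} (hε : 0 < ε) : {x | ε ≤ |f x|}.Finite := by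
  have h0 : Tendsto (fun y => |f y|) cofinite (𝓝 0) := by
    rw [← cocompact_eq_cofinite]
    simpa using (zero_at_infty f).abs
  simpa using h0.eventually (gt_mem_nhds hε)

/-- A function on a discrete space, small outside of finite sets, as an element of `C₀`. -/
def ofFinite (f : X → ℝ) (h : ∀ ε : ℝ, 0 < ε → {x | ε ≤ |f x|}.Finite) : C₀(X, ℝ) where
  toFun := f
  continuous_toFun := continuous_of_discreteTopology
  zero_at_infty' := by
    rw [cocompact_eq_cofinite, Metric.tendsto_nhds]
    intro ε hε
    simpa using h ε hε

@[simp]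
theorem coe_ofFinite (f : X → ℝ) (h : ∀ ε : ℝ, 0 < ε → {x | ε ≤ |f x|}.Finite) :
    ⇑(ofFinite f h) = f := rfl

/-- A finitely supported function on a discrete space as an element of `C₀`. -/
def ofFiniteSupport (f : X → ℝ) (h : f.support.Finite) : C₀(X, ℝ) :=
  ofFinite f fun _ hε => h.subset fun _ hx => abs_pos.1 (hε.trans_le hx)

open scoped Classical in
/-- The indicator function of a point. -/
noncomputable def delta (y : X) : C₀(X, ℝ) :=
  ofFiniteSupport (Pi.single y 1) ((Set.finite_singleton y).subset (by
    intro x hx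
    by_contra hxy
    exact hx (Pi.single_eq_of_ne hxy 1)))

theorem delta_self (y : X) : delta y y = 1 := by classical exact Pi.single_eq_same y 1

theorem delta_of_ne {x y : X} (h : x ≠ y) : delta y x = 0 := by
  classical exact Pi.single_eq_of_ne h 1

theorem sum_smul_delta_apply (s : Finset X) (a : X → ℝ) (x : X) [Decidable (x ∈ s)] :
    (∑ y ∈ s, a y • delta y) x = if x ∈ s then a x else 0 := by
  rw [sum_apply]
  simp only [ZeroAtInftyContinuousMap.smul_apply, smul_eq_mul]
  split_ifs with h
  · rw [Finset.sum_eq_single x (fun y _ hy => by rw [delta_of_ne hy.symm, mul_zero])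
      (fun h' => absurd h h'), delta_self, mul_one]
  · refine Finset.sum_eq_zero fun y hy => ?_
    rw [delta_of_ne (fun e => h (by rwa [e])), mul_zero]

/-- Used twice: for density of the domain, and to recover an operator from its values on point
masses. -/
theorem hasSum_smul_delta (f : C₀(X, ℝ)) : HasSum (fun y => f y • delta y) f := by
  classical
  rw [HasSum, SummationFilter.unconditional_filter, Metric.tendsto_atTop]
  intro ε hε
  have hfin := finite_le_abs f (half_pos hε)
  refine ⟨hfin.toFinset, fun s hs => ?_⟩
  rw [dist_eq_norm]
  refine (norm_le_of_forall (half_pos hε).le fun x => ?_).trans_lt (half_lt_self hε)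
  rw [ZeroAtInftyContinuousMap.sub_apply, sum_smul_delta_apply]
  split_ifs with h
  · rw [sub_self, abs_zero]
    exact (half_pos hε).le
  · by_contra! h'
    refine h (hs (hfin.mem_toFinset.2 ?_))
    rw [zero_sub, abs_neg] at h'
    exact h'.le

end DiscreteC0

/-! ### Jump operators with finitely many jumps from each point -/

namespace JumpProcess

variable {X ι : Type*} [Fintype ι]

/-- The operator `f ↦ ∑ i, q x i (f (σ x i) - f x)` of a jump process with rates `q` and
targets `σ`. -/
def jumpOp (q : X → ι → ℝ) (σ : X → ι → X) : (X → ℝ) →ₗ[ℝ] (X → ℝ) where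
  toFun f x := ∑ i, q x i * (f (σ x i) - f x)
  map_add' f g := by
    funext x
    simp only [Pi.add_apply, ← Finset.sum_add_distrib]
    exact Finset.sum_congr rfl fun i _ => by ring
  map_smul' c f := by
    funext x
    simp only [Pi.smul_apply, smul_eq_mul, RingHom.id_apply, Finset.mul_sum]
    exact Finset.sum_congr rfl fun i _ => by ring

variable {q : X → ι → ℝ} {σ : X → ι → X}

theorem jumpOp_apply (f : X → ℝ) (x : X) :
    jumpOp q σ f x = ∑ i, q x i * (f (σ x i) - f x) := rfl

/-- The quadratic form `∑ i, q x i (f (σ x i) - f x)²` of a jump process. -/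
def energy (q : X → ι → ℝ) (σ : X → ι → X) (f : X → ℝ) (x : X) : ℝ :=
  ∑ i, q x i * (f (σ x i) - f x) ^ 2

/-- A nonnegative proper function whose increments are controlled in the first two orders. -/
structure IsLyapunov (q : X → ι → ℝ) (σ : X → ι → X) (φ : X → ℝ) (C : ℝ) : Prop where
  nonneg : ∀ x, 0 ≤ φ x
  proper : ∀ c, {x | φ x ≤ c}.Finite
  abs_jumpOp_le : ∀ x, |jumpOp q σ φ x| ≤ C
  energy_le : ∀ x, energy q σ φ x ≤ C

/-! ### From a proper function to its logarithm -/

/-- The bounds 1 - 1/r ≤ log r ≤ r - 1 differ by (r - 1)²/r. The threshold 1/3 matches the ratio by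
which one jump may decrease ψ. -/
theorem abs_log_sub_le {r : ℝ} (hr : 1 / 3 ≤ r) : |Real.log r - (r - 1)| ≤ 3 * (r - 1) ^ 2 := by
  have h0 : 0 < r := by linarith
  have h1 := Real.log_le_sub_one_of_pos h0
  have h2 := Real.one_sub_inv_le_log_of_pos h0
  have h3 : 1 - r⁻¹ - (r - 1) = -((r - 1) ^ 2 / r) := by
    field_simp
    ring
  have h4 : (r - 1) ^ 2 / r ≤ 3 * (r - 1) ^ 2 := by
    rw [div_le_iff₀ h0]
    nlinarith [sq_nonneg (r - 1)]
  rw [abs_le]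
  constructor <;> nlinarith [sq_nonneg (r - 1)]

theorem log_sq_le {r : ℝ} (hr : 1 / 3 ≤ r) : Real.log r ^ 2 ≤ 9 * (r - 1) ^ 2 := by
  have h0 : 0 < r := by linarith
  have h1 := Real.log_le_sub_one_of_pos h0
  have h2 := Real.one_sub_inv_le_log_of_pos h0
  have h3 : 1 - r⁻¹ = (r - 1) / r := by field_simp
  rw [h3, div_le_iff₀ h0] at h2
  rw [show 9 * (r - 1) ^ 2 = (3 * (r - 1)) ^ 2 by ring, sq_le_sq]
  rcases le_total 1 r with h | h
  · have := Real.log_nonneg h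
    rw [abs_of_nonneg this, abs_of_nonneg (by linarith)]
    linarith
  · have := Real.log_nonpos h0.le h
    rw [abs_of_nonpos this, abs_of_nonpos (by linarith)]
    nlinarith

/-- The logarithm of a proper function with relatively bounded drift and energy is a Lyapunov
function. -/
theorem IsLyapunov.log (hq : ∀ x i, 0 ≤ q x i) {ψ : X → ℝ} {C : ℝ} (hC : 0 ≤ C)
    (h1 : ∀ x, 1 ≤ ψ x) (hproper : ∀ c, {x | ψ x ≤ c}.Finite)
    (hjump : ∀ x, |jumpOp q σ ψ x| ≤ C * ψ x) (henergy : ∀ x, energy q σ ψ x ≤ C * ψ x ^ 2)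
    (hcomp : ∀ x i, ψ x ≤ 3 * ψ (σ x i)) :
    IsLyapunov q σ (fun x => Real.log (ψ x)) (9 * C) := by
  have hpos : ∀ x, 0 < ψ x := fun x => one_pos.trans_le (h1 x)
  have hr : ∀ x i, 1 / 3 ≤ ψ (σ x i) / ψ x := fun x i => by
    rw [le_div_iff₀ (hpos x)]
    linarith [hcomp x i]
  have hlog : ∀ x i, Real.log (ψ (σ x i)) - Real.log (ψ x) = Real.log (ψ (σ x i) / ψ x) :=
    fun x i => (Real.log_div (hpos _).ne' (hpos _).ne').symm
  have hsub : ∀ x i, ψ (σ x i) / ψ x - 1 = (ψ (σ x i) - ψ x) / ψ x := fun x i => by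
    field_simp [(hpos x).ne']
  have hE : ∀ x, ∑ i, q x i * (ψ (σ x i) / ψ x - 1) ^ 2 ≤ C := fun x => by
    have : ∑ i, q x i * (ψ (σ x i) / ψ x - 1) ^ 2 = energy q σ ψ x / ψ x ^ 2 := by
      rw [energy, Finset.sum_div]
      refine Finset.sum_congr rfl fun i _ => ?_
      rw [hsub, div_pow, mul_div_assoc]
    rw [this, div_le_iff₀ (by have := hpos x; positivity)]
    exact henergy x
  refine ⟨fun x => Real.log_nonneg (h1 x), fun c => (hproper (Real.exp c)).subset fun x hx => ?_,
    fun x => ?_, fun x => ?_⟩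
  · exact (Real.log_le_iff_le_exp (hpos x)).1 hx
  -- First-order expansion of log: the linear part is Dψ/ψ, and the remainder is controlled by the
  -- energy of ψ over ψ².
  · have e : jumpOp q σ (fun x => Real.log (ψ x)) x = jumpOp q σ ψ x / ψ x
        + ∑ i, q x i * (Real.log (ψ (σ x i) / ψ x) - (ψ (σ x i) / ψ x - 1)) := by
      rw [jumpOp_apply, jumpOp_apply, Finset.sum_div, ← Finset.sum_add_distrib]
      refine Finset.sum_congr rfl fun i _ => ?_
      rw [hlog, hsub]
      ring
    have hA : |jumpOp q σ ψ x / ψ x| ≤ C := by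
      rw [abs_div, abs_of_pos (hpos x), div_le_iff₀ (hpos x)]
      exact hjump x
    have hB : |∑ i, q x i * (Real.log (ψ (σ x i) / ψ x) - (ψ (σ x i) / ψ x - 1))| ≤ 3 * C := by
      refine (Finset.abs_sum_le_sum_abs _ _).trans
        (le_trans ?_ (mul_le_mul_of_nonneg_left (hE x) (by norm_num : (0 : ℝ) ≤ 3)))
      rw [Finset.mul_sum]
      refine Finset.sum_le_sum fun i _ => ?_
      rw [abs_mul, abs_of_nonneg (hq x i), mul_left_comm]
      exact mul_le_mul_of_nonneg_left (abs_log_sub_le (hr x i)) (hq x i)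
    rw [e]
    linarith [abs_add_le (jumpOp q σ ψ x / ψ x)
      (∑ i, q x i * (Real.log (ψ (σ x i) / ψ x) - (ψ (σ x i) / ψ x - 1)))]
  · refine le_trans ?_ (mul_le_mul_of_nonneg_left (hE x) (by norm_num : (0 : ℝ) ≤ 9))
    rw [energy, Finset.mul_sum]
    refine Finset.sum_le_sum fun i _ => ?_
    rw [hlog, mul_left_comm]
    exact mul_le_mul_of_nonneg_left (log_sq_le (hr x i)) (hq x i)

/-! #### Slowly varying barriers -/

/-- The function `1 / (1 + ε φ)`. -/
noncomputable def barrier (φ : X → ℝ) (ε : ℝ) (x : X) : ℝ := (1 + ε * φ x)⁻¹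

namespace IsLyapunov

variable {φ : X → ℝ} {C ε : ℝ}

theorem one_le_one_add (hφ : IsLyapunov q σ φ C) (hε : 0 ≤ ε) (x : X) : 1 ≤ 1 + ε * φ x := by
  have := mul_nonneg hε (hφ.nonneg x)
  linarith

theorem barrier_pos (hφ : IsLyapunov q σ φ C) (hε : 0 ≤ ε) (x : X) : 0 < barrier φ ε x :=
  inv_pos.2 (one_pos.trans_le (hφ.one_le_one_add hε x))

theorem barrier_le_one (hφ : IsLyapunov q σ φ C) (hε : 0 ≤ ε) (x : X) : barrier φ ε x ≤ 1 :=
  inv_le_one_of_one_le₀ (hφ.one_le_one_add hε x)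

/-- The second-order expansion of u ↦ 1/(1 + εu) is exact, with remainder ε² b(x)² b(y) (φ(y) -
φ(x))² for a jump from x to y. The drift bounds the linear term, the energy the remainder. The
factor b² makes the image of the barrier vanish at infinity. -/
theorem abs_jumpOp_barrier_le (hφ : IsLyapunov q σ φ C) (hq : ∀ x i, 0 ≤ q x i) (hε : 0 ≤ ε)
    (hε1 : ε ≤ 1) (x : X) :
    |jumpOp q σ (barrier φ ε) x| ≤ 2 * C * ε * barrier φ ε x ^ 2 := by
  have hu : ∀ y, 0 < 1 + ε * φ y := fun y => one_pos.trans_le (hφ.one_le_one_add hε y)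
  have hb := (hφ.barrier_pos hε x).le
  have e : jumpOp q σ (barrier φ ε) x = barrier φ ε x ^ 2 * (-(ε * jumpOp q σ φ x)
      + ε ^ 2 * ∑ i, q x i * (barrier φ ε (σ x i) * (φ (σ x i) - φ x) ^ 2)) := by
    rw [jumpOp_apply, jumpOp_apply, Finset.mul_sum, Finset.mul_sum, ← Finset.sum_neg_distrib,
      ← Finset.sum_add_distrib, Finset.mul_sum]
    refine Finset.sum_congr rfl fun i _ => ?_
    have h1 := (hu x).ne'
    have h2 := (hu (σ x i)).ne'
    unfold barrier
    field_simp
    ring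
  have hC : 0 ≤ C := (abs_nonneg _).trans (hφ.abs_jumpOp_le x)
  have hS0 : 0 ≤ ∑ i, q x i * (barrier φ ε (σ x i) * (φ (σ x i) - φ x) ^ 2) :=
    Finset.sum_nonneg fun i _ => mul_nonneg (hq x i)
      (mul_nonneg (hφ.barrier_pos hε _).le (sq_nonneg _))
  have hS : ∑ i, q x i * (barrier φ ε (σ x i) * (φ (σ x i) - φ x) ^ 2) ≤ C := by
    refine le_trans (Finset.sum_le_sum fun i _ => mul_le_mul_of_nonneg_left ?_ (hq x i))
      (hφ.energy_le x)
    exact mul_le_of_le_one_left (sq_nonneg _) (hφ.barrier_le_one hε _)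
  have hA : |-(ε * jumpOp q σ φ x)| ≤ ε * C := by
    rw [abs_neg, abs_mul, abs_of_nonneg hε]
    exact mul_le_mul_of_nonneg_left (hφ.abs_jumpOp_le x) hε
  have hB : |ε ^ 2 * ∑ i, q x i * (barrier φ ε (σ x i) * (φ (σ x i) - φ x) ^ 2)| ≤ ε * C := by
    rw [abs_of_nonneg (by positivity)]
    have : ε ^ 2 ≤ ε := by nlinarith
    gcongr
  rw [e, abs_mul, abs_of_nonneg (sq_nonneg (barrier φ ε x)), mul_comm]
  refine mul_le_mul_of_nonneg_right ?_ (sq_nonneg _)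
  refine (abs_add_le _ _).trans ?_
  linarith

/-- Equivalently (c - D) b ≥ (c - 2C) b, which is where the threshold 2C for the resolvent comes
from. -/
theorem jumpOp_barrier_le (hφ : IsLyapunov q σ φ C) (hq : ∀ x i, 0 ≤ q x i) (x : X) :
    jumpOp q σ (barrier φ 1) x ≤ 2 * C * barrier φ 1 x := by
  have hC : 0 ≤ C := (abs_nonneg _).trans (hφ.abs_jumpOp_le x)
  refine (le_abs_self _).trans ((hφ.abs_jumpOp_barrier_le hq zero_le_one le_rfl x).trans ?_)
  rw [mul_one]
  refine mul_le_mul_of_nonneg_left ?_ (by positivity)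
  have h0 := hφ.barrier_pos zero_le_one x
  have h1 := hφ.barrier_le_one zero_le_one x
  nlinarith

theorem finite_le_barrier (hφ : IsLyapunov q σ φ C) (hε : 0 < ε) {δ : ℝ} (hδ : 0 < δ) :
    {x | δ ≤ barrier φ ε x}.Finite := by
  refine (hφ.proper (δ⁻¹ / ε)).subset fun x hx => ?_
  have h1 : 0 < 1 + ε * φ x := one_pos.trans_le (hφ.one_le_one_add hε.le x)
  have h2 : 1 + ε * φ x ≤ δ⁻¹ := (le_inv_comm₀ hδ h1).1 hx
  rw [Set.mem_ofPred_eq, le_div_iff₀ hε, mul_comm]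
  linarith

theorem tendsto_barrier (x : X) : Tendsto (fun ε => barrier φ ε x) (𝓝 0) (𝓝 1) := by
  have : ContinuousAt (fun ε => barrier φ ε x) 0 := by
    unfold barrier
    refine ContinuousAt.inv₀ (by fun_prop) (by simp)
  simpa [ContinuousAt, barrier] using this

end IsLyapunov

/-! #### Supersolutions and the resolvent equation -/

/-- The fixed points of this monotone map are the solutions of `c f - D f = g`. -/
noncomputable def resolventStep (q : X → ι → ℝ) (σ : X → ι → X) (c : ℝ) (g u : X → ℝ) (x : X) : ℝ :=
  (g x + ∑ i, q x i * u (σ x i)) / (c + ∑ i, q x i)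

theorem jumpOp_eq_sub (f : X → ℝ) (x : X) :
    jumpOp q σ f x = ∑ i, q x i * f (σ x i) - (∑ i, q x i) * f x := by
  rw [jumpOp_apply, Finset.sum_mul, ← Finset.sum_sub_distrib]
  exact Finset.sum_congr rfl fun i _ => by ring

section Resolvent

variable {c : ℝ}

theorem add_sum_pos (hq : ∀ x i, 0 ≤ q x i) (hc : 0 < c) (x : X) : 0 < c + ∑ i, q x i :=
  add_pos_of_pos_of_nonneg hc (Finset.sum_nonneg fun i _ => hq x i)

theorem resolventStep_mono (hq : ∀ x i, 0 ≤ q x i) (hc : 0 < c) (g : X → ℝ) :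
    Monotone (resolventStep q σ c g) := fun u v h x => by
  unfold resolventStep
  have h0 := (add_sum_pos hq hc x).le
  gcongr with i
  · exact hq x i
  · exact h (σ x i)

theorem resolventStep_le (hq : ∀ x i, 0 ≤ q x i) (hc : 0 < c) {g H : X → ℝ}
    (hH : ∀ x, g x ≤ c * H x - jumpOp q σ H x) : resolventStep q σ c g H ≤ H := fun x => by
  unfold resolventStep
  rw [div_le_iff₀ (add_sum_pos hq hc x)]
  have := hH x
  rw [jumpOp_eq_sub] at this
  linarith

/-- The minimal nonnegative solution of `c f - D f = g`, which lies below every nonnegative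
supersolution. -/
theorem exists_minimal_solution (hq : ∀ x i, 0 ≤ q x i) (hc : 0 < c) {g H₀ : X → ℝ}
    (hg : ∀ x, 0 ≤ g x) (hH₀ : ∀ x, 0 ≤ H₀ x) (hH₀' : ∀ x, g x ≤ c * H₀ x - jumpOp q σ H₀ x) :
    ∃ f : X → ℝ, (∀ x, 0 ≤ f x) ∧ (∀ x, c * f x - jumpOp q σ f x = g x) ∧
      ∀ H : X → ℝ, (∀ x, 0 ≤ H x) → (∀ x, g x ≤ c * H x - jumpOp q σ H x) → ∀ x, f x ≤ H x := by
  -- Monotone iteration from 0: the iterates increase and stay below every nonnegative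
  -- supersolution. Each point has finitely many targets, so the limit passes through the step.
  let u : ℕ → X → ℝ := fun n => (resolventStep q σ c g)^[n] 0
  have hmono : Monotone u := by
    refine (resolventStep_mono hq hc g).monotone_iterate_of_le_map fun x => ?_
    simp only [resolventStep, Pi.zero_apply, mul_zero, Finset.sum_const_zero, add_zero]
    exact div_nonneg (hg x) (add_sum_pos hq hc x).le
  have hle : ∀ H : X → ℝ, (∀ x, 0 ≤ H x) → (∀ x, g x ≤ c * H x - jumpOp q σ H x) →
      ∀ n, u n ≤ H := fun H h0 h1 n => by
    induction n with
    | zero => exact h0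
    | succ n ih =>
      simp only [u, Function.iterate_succ_apply']
      exact (resolventStep_mono hq hc g ih).trans (resolventStep_le hq hc h1)
  have hlim : ∀ x, Tendsto (fun n => u n x) atTop (𝓝 (⨆ n, u n x)) := fun x =>
    tendsto_atTop_ciSup (fun _ _ h => hmono h x)
      ⟨H₀ x, by rintro _ ⟨n, rfl⟩; exact hle H₀ hH₀ hH₀' n x⟩
  refine ⟨fun x => ⨆ n, u n x, fun x => ?_, fun x => ?_, fun H h0 h1 x => ?_⟩
  · exact ge_of_tendsto' (hlim x) fun n => hmono (Nat.zero_le n) x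
  · have h1 : Tendsto (fun n => u (n + 1) x) atTop
        (𝓝 (resolventStep q σ c g (fun x => ⨆ n, u n x) x)) := by
      simp only [u, Function.iterate_succ_apply']
      exact (tendsto_const_nhds.add (tendsto_finsetSum _ fun i _ =>
        (hlim (σ x i)).const_mul _)).div_const _
    have h2 := tendsto_nhds_unique ((hlim x).comp (tendsto_add_atTop_nat 1)) h1
    rw [resolventStep, eq_div_iff (add_sum_pos hq hc x).ne'] at h2
    rw [jumpOp_eq_sub]
    linarith
  · exact le_of_tendsto' (hlim x) fun n => hle H h0 h1 n x

end Resolvent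

end JumpProcess

/-! ### Feller semigroups of jump processes -/

namespace JumpProcess

open FellerZW DiscreteC0

variable {X ι : Type*} [Fintype ι] [TopologicalSpace X]

theorem maximalOperator_apply {D : (X → ℝ) →ₗ[ℝ] (X → ℝ)} (f : (maximalOperator D).domain) :
    ⇑(maximalOperator D f) = D (f : C₀(X, ℝ)) := Classical.choose_spec f.2

variable {q : X → ι → ℝ} {σ : X → ι → X}

/-- Maximum principle: where |f| is maximal, D f vanishes or has the sign opposite to f, so |c f - D
f| ≥ c |f| there. -/
theorem dissipative_maximalOperator (hq : ∀ x i, 0 ≤ q x i) :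
    HilleYosida.Dissipative (maximalOperator (jumpOp q σ)) := by
  intro c hc f
  rcases eq_or_ne (f : C₀(X, ℝ)) 0 with h0 | h0
  · rw [h0, norm_zero, mul_zero]
    exact norm_nonneg _
  obtain ⟨x, hx, hmax⟩ := exists_abs_apply_max (f : C₀(X, ℝ)) h0
  have hnorm : ‖(f : C₀(X, ℝ))‖ ≤ |(f : C₀(X, ℝ)) x| := norm_le_of_forall (abs_nonneg _) hmax
  refine (mul_le_mul_of_nonneg_left hnorm hc.le).trans
    (le_trans ?_ (abs_apply_le_norm (c • (f : C₀(X, ℝ)) - maximalOperator (jumpOp q σ) f) x))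
  rw [ZeroAtInftyContinuousMap.sub_apply, ZeroAtInftyContinuousMap.smul_apply, smul_eq_mul,
    maximalOperator_apply, jumpOp_apply]
  rcases lt_or_gt_of_ne hx with hneg | hpos
  · have hD : 0 ≤ ∑ i, q x i * ((f : C₀(X, ℝ)) (σ x i) - (f : C₀(X, ℝ)) x) :=
      Finset.sum_nonneg fun i _ => mul_nonneg (hq x i) (by
        have := hmax (σ x i)
        rw [abs_of_neg hneg] at this
        linarith [neg_abs_le ((f : C₀(X, ℝ)) (σ x i))])
    rw [abs_of_neg hneg, ← neg_sub, abs_neg]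
    refine le_trans ?_ (le_abs_self _)
    linarith
  · have hD : ∑ i, q x i * ((f : C₀(X, ℝ)) (σ x i) - (f : C₀(X, ℝ)) x) ≤ 0 :=
      Finset.sum_nonpos fun i _ => mul_nonpos_of_nonneg_of_nonpos (hq x i) (by
        have := hmax (σ x i)
        rw [abs_of_pos hpos] at this
        linarith [le_abs_self ((f : C₀(X, ℝ)) (σ x i))])
    rw [abs_of_pos hpos]
    refine le_trans ?_ (le_abs_self _)
    linarith

/-- A contraction `T` of `C₀(X)` that is conservative, in the sense that the values at `x` of
`T h` and `h` are arbitrarily close to `1` for suitable `0 ≤ h ≤ 1`, is positive. -/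
theorem apply_nonneg_of_conservative {T : C₀(X, ℝ) →L[ℝ] C₀(X, ℝ)} (hT : ∀ f, ‖T f‖ ≤ ‖f‖) {x : X}
    (hcons : ∀ δ : ℝ, 0 < δ → ∃ h : C₀(X, ℝ), (∀ y, 0 ≤ h y) ∧ (∀ y, h y ≤ 1) ∧ 1 - δ ≤ T h x)
    {f : C₀(X, ℝ)} (hf0 : ∀ y, 0 ≤ f y) (hf1 : ∀ y, f y ≤ 1) : 0 ≤ T f x := by
  refine le_of_forall_pos_le_add fun δ hδ => ?_
  obtain ⟨h, h0, h1, hh⟩ := hcons δ hδ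
  -- Contractivity gives T h - T f ≤ 1 at x, while T h is at least 1 - δ there.
  have hn : ‖h - f‖ ≤ 1 := norm_le_of_forall zero_le_one fun y => by
    rw [ZeroAtInftyContinuousMap.sub_apply, abs_le]
    constructor <;> linarith [h0 y, h1 y, hf0 y, hf1 y]
  have := (le_abs_self _).trans ((abs_apply_le_norm (T (h - f)) x).trans ((hT _).trans hn))
  rw [map_sub, ZeroAtInftyContinuousMap.sub_apply] at this
  linarith

variable [DiscreteTopology X]

/-- The image of a point mass lives on the point and the states that jump to it, a finite set. -/
theorem delta_mem_domain (hσ : ∀ y, {x | ∃ i, σ x i = y}.Finite) (y : X) :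
    delta y ∈ (maximalOperator (jumpOp q σ)).domain := by
  refine ⟨ofFiniteSupport (jumpOp q σ (delta y)) (((hσ y).union (Set.finite_singleton y)).subset
    fun x hx => ?_), rfl⟩
  by_contra h
  simp only [Set.mem_union, Set.mem_ofPred_eq, Set.mem_singleton_iff, not_or, not_exists] at h
  refine hx ?_
  rw [jumpOp_apply]
  refine Finset.sum_eq_zero fun i _ => ?_
  rw [delta_of_ne h.2, delta_of_ne (h.1 i), sub_zero, mul_zero]

theorem dense_domain (hσ : ∀ y, {x | ∃ i, σ x i = y}.Finite) :
    Dense ((maximalOperator (jumpOp q σ)).domain : Set C₀(X, ℝ)) := fun f =>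
  mem_closure_of_tendsto (hasSum_smul_delta f) (Eventually.of_forall fun _ =>
    Submodule.sum_mem _ fun y _ => Submodule.smul_mem _ _ (delta_mem_domain hσ y))

/-! ### The resolvent equation in C₀ and approximate units -/

variable {φ : X → ℝ} {C : ℝ}

theorem exists_le_add_barrier (hφ : IsLyapunov q σ φ C) (g : C₀(X, ℝ)) {ε : ℝ} (hε : 0 < ε) :
    ∃ a : ℝ, 0 ≤ a ∧ ∀ x, g x ≤ ε + a * barrier φ 1 x := by
  obtain ⟨a, ha⟩ := ((finite_le_abs g hε).image fun x => |g x| / barrier φ 1 x).bddAbove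
  have hb := hφ.barrier_pos zero_le_one
  refine ⟨max a 0, le_max_right _ _, fun x => ?_⟩
  have hm : 0 ≤ max a 0 * barrier φ 1 x := mul_nonneg (le_max_right _ _) (hb x).le
  by_cases hx : ε ≤ |g x|
  · have h1 : |g x| / barrier φ 1 x ≤ max a 0 :=
      (ha (Set.mem_image_of_mem _ hx)).trans (le_max_left _ _)
    rw [div_le_iff₀ (hb x)] at h1
    linarith [le_abs_self (g x)]
  · linarith [le_abs_self (g x)]

/-- For every ε > 0 some ε + a b, with b the barrier at parameter 1, is a supersolution. One minimal
solution lies below all of these, hence vanishes at infinity. -/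
theorem exists_solution_of_nonneg (hφ : IsLyapunov q σ φ C) (hq : ∀ x i, 0 ≤ q x i) {c : ℝ}
    (hc : 2 * C < c) (g : C₀(X, ℝ)) (hg : ∀ x, 0 ≤ g x) :
    ∃ f : C₀(X, ℝ), ∀ x, c * f x - jumpOp q σ f x = g x := by
  rcases isEmpty_or_nonempty X with hX | ⟨⟨x₀⟩⟩
  · exact ⟨0, fun x => isEmptyElim x⟩
  have hC : 0 ≤ C := (abs_nonneg _).trans (hφ.abs_jumpOp_le x₀)
  have hc0 : 0 < c := by linarith
  have hsup : ∀ ε : ℝ, 0 < ε → ∃ a : ℝ, 0 ≤ a ∧ ∀ x, g x ≤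
      c * (fun x => ε + a * barrier φ 1 x) x - jumpOp q σ (fun x => ε + a * barrier φ 1 x) x := by
    intro ε hε
    -- Since D annihilates constants, c - D maps ε to cε; it maps b to at least (c - 2C) b, hence
    -- the later division of a by c - 2C.
    obtain ⟨a, ha, h⟩ := exists_le_add_barrier hφ g (mul_pos hc0 hε)
    have hd : 0 < c - 2 * C := by linarith
    refine ⟨a / (c - 2 * C), by positivity, fun x => (h x).trans ?_⟩
    have e : jumpOp q σ (fun x => ε + a / (c - 2 * C) * barrier φ 1 x) x
        = a / (c - 2 * C) * jumpOp q σ (barrier φ 1) x := by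
      rw [jumpOp_apply, jumpOp_apply, Finset.mul_sum]
      exact Finset.sum_congr rfl fun i _ => by ring
    have h1 := mul_le_mul_of_nonneg_left (hφ.jumpOp_barrier_le hq x)
      (show 0 ≤ a / (c - 2 * C) by positivity)
    have h2 : a * barrier φ 1 x = a / (c - 2 * C) * ((c - 2 * C) * barrier φ 1 x) := by
      field_simp
    rw [e, h2]
    linarith
  have hpos : ∀ {ε a : ℝ}, 0 < ε → 0 ≤ a → ∀ x, 0 ≤ ε + a * barrier φ 1 x := fun hε ha x => by
    have := (hφ.barrier_pos zero_le_one x).le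
    positivity
  obtain ⟨a, ha, h⟩ := hsup 1 one_pos
  obtain ⟨f, hf0, hf, hmin⟩ := exists_minimal_solution hq hc0 hg (hpos one_pos ha) h
  refine ⟨ofFinite f fun ε hε => ?_, hf⟩
  obtain ⟨b, hb, h⟩ := hsup (ε / 2) (half_pos hε)
  refine (hφ.finite_le_barrier one_pos (δ := ε / 2 / (b + 1)) (by positivity)).subset
    fun x hx => ?_
  have h1 := hmin _ (hpos (half_pos hε) hb) h x
  have h2 : ε ≤ |f x| := hx
  rw [abs_of_nonneg (hf0 x)] at h2
  rw [Set.mem_ofPred_eq, div_le_iff₀ (by positivity)]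
  have := hφ.barrier_pos zero_le_one x
  nlinarith

theorem exists_solution (hφ : IsLyapunov q σ φ C) (hq : ∀ x i, 0 ≤ q x i) {c : ℝ}
    (hc : 2 * C < c) (g : C₀(X, ℝ)) :
    ∃ f : (maximalOperator (jumpOp q σ)).domain,
      c • (f : C₀(X, ℝ)) - maximalOperator (jumpOp q σ) f = g := by
  have hmem : ∀ (s : ℝ → ℝ), (∀ t, |s t| ≤ |t|) → ∀ ε : ℝ, 0 < ε → {x | ε ≤ |s (g x)|}.Finite :=
    fun s hs ε hε => (finite_le_abs g hε).subset fun x hx => le_trans hx (hs (g x))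
  have hp : ∀ t : ℝ, |max t 0| ≤ |t| := fun t => by
    rw [abs_of_nonneg (le_max_right t 0)]
    exact max_le (le_abs_self t) (abs_nonneg t)
  obtain ⟨f₁, hf₁⟩ := exists_solution_of_nonneg hφ hq hc
    (ofFinite (fun x => max (g x) 0) (hmem _ hp)) fun x => le_max_right _ _
  obtain ⟨f₂, hf₂⟩ := exists_solution_of_nonneg hφ hq hc
    (ofFinite (fun x => max (-g x) 0) (hmem (fun t => max (-t) 0) fun t => by
      simpa using hp (-t))) fun x => le_max_right _ _
  have hD : ⇑(c • (f₁ - f₂) - g) = jumpOp q σ (f₁ - f₂ : C₀(X, ℝ)) := by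
    funext x
    have h1 := hf₁ x
    have h2 := hf₂ x
    have h3 := max_zero_sub_max_neg_zero_eq_self (g x)
    simp only [coe_ofFinite] at h1 h2
    rw [ZeroAtInftyContinuousMap.coe_sub f₁, map_sub]
    simp only [ZeroAtInftyContinuousMap.sub_apply, ZeroAtInftyContinuousMap.smul_apply,
      smul_eq_mul, Pi.sub_apply]
    linarith
  refine ⟨⟨f₁ - f₂, c • (f₁ - f₂) - g, hD⟩, DFunLike.coe_injective ?_⟩
  rw [ZeroAtInftyContinuousMap.coe_sub, maximalOperator_apply]
  refine (congrArg (⇑(c • (f₁ - f₂)) - ·) hD.symm).trans ?_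
  rw [← ZeroAtInftyContinuousMap.coe_sub, sub_sub_cancel]

/-- Approximate units: as ε → 0 they tend to 1 pointwise while their images tend to 0 uniformly. The
absolute value of C covers empty X, where C may be negative. -/
theorem exists_barrier_mem_domain (hφ : IsLyapunov q σ φ C) (hq : ∀ x i, 0 ≤ q x i) {ε : ℝ}
    (hε : 0 < ε) (hε1 : ε ≤ 1) :
    ∃ h : (maximalOperator (jumpOp q σ)).domain, ⇑(h : C₀(X, ℝ)) = barrier φ ε ∧
      ‖maximalOperator (jumpOp q σ) h‖ ≤ 2 * |C| * ε := by
  have hb : ∀ x, 0 ≤ barrier φ ε x := fun x => (hφ.barrier_pos hε.le x).le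
  have hle : ∀ x, |jumpOp q σ (barrier φ ε) x| ≤ 2 * |C| * ε * barrier φ ε x ^ 2 := fun x =>
    (hφ.abs_jumpOp_barrier_le hq hε.le hε1 x).trans (by gcongr; exact le_abs_self C)
  have hsq : ∀ x, barrier φ ε x ^ 2 ≤ barrier φ ε x := fun x => by
    have := hφ.barrier_le_one hε.le x
    nlinarith [hb x]
  let h : C₀(X, ℝ) := ofFinite (barrier φ ε) fun δ hδ => by
    simpa only [abs_of_nonneg (hb _)] using hφ.finite_le_barrier hε hδ
  have hmem : h ∈ (maximalOperator (jumpOp q σ)).domain := by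
    refine ⟨ofFinite (jumpOp q σ (barrier φ ε)) fun δ hδ => ?_, rfl⟩
    refine (hφ.finite_le_barrier hε (δ := δ / (2 * |C| * ε + 1)) (by positivity)).subset
      fun x hx => ?_
    rw [Set.mem_ofPred_eq, div_le_iff₀ (by positivity)]
    have h1 := hle x
    have h2 : δ ≤ |jumpOp q σ (barrier φ ε) x| := hx
    have h3 := mul_le_mul_of_nonneg_left (hsq x) (show 0 ≤ 2 * |C| * ε by positivity)
    have h4 := hb x
    nlinarith
  refine ⟨⟨h, hmem⟩, rfl, norm_le_of_forall (by positivity) fun x => ?_⟩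
  rw [maximalOperator_apply]
  refine (hle x).trans (mul_le_of_le_one_right (by positivity) ?_)
  exact (hsq x).trans (hφ.barrier_le_one hε.le x)

/-! #### Markov kernels -/

theorem hasSum_apply_delta (T : C₀(X, ℝ) →L[ℝ] C₀(X, ℝ)) (x : X) (f : C₀(X, ℝ)) :
    HasSum (fun y => f y * T (delta y) x) (T f x) := by
  have h1 := (hasSum_smul_delta f).mapL T
  have h2 : Tendsto (fun g : C₀(X, ℝ) => g x) (𝓝 (T f)) (𝓝 (T f x)) :=
    ((tendsto_iff_norm_sub_tendsto_zero).2 (squeeze_zero (fun _ => norm_nonneg _)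
      (fun g => abs_apply_le_norm (g - T f) x) (tendsto_iff_norm_sub_tendsto_zero.1 tendsto_id)))
  refine (h2.comp h1).congr fun s => ?_
  simp [DiscreteC0.sum_apply]

/-- Indicators of finite sets have norm at most 1, so the total mass is at most 1; conservativity
gives the reverse bound and positivity. -/
theorem exists_pmf (T : C₀(X, ℝ) →L[ℝ] C₀(X, ℝ)) (hT : ∀ f, ‖T f‖ ≤ ‖f‖) (x : X)
    (hcons : ∀ δ : ℝ, 0 < δ → ∃ h : C₀(X, ℝ), (∀ y, 0 ≤ h y) ∧ (∀ y, h y ≤ 1) ∧ 1 - δ ≤ T h x) :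
    ∃ p : PMF X, ∀ y, (p y).toReal = T (delta y) x := by
  classical
  have hδ0 : ∀ y z : X, 0 ≤ delta y z := fun y z => by
    rcases eq_or_ne z y with rfl | h
    · rw [delta_self]
      exact zero_le_one
    · rw [delta_of_ne h]
  have hδ1 : ∀ y z : X, delta y z ≤ 1 := fun y z => by
    rcases eq_or_ne z y with rfl | h
    · rw [delta_self]
    · rw [delta_of_ne h]
      exact zero_le_one
  have h0 : ∀ y, 0 ≤ T (delta y) x := fun y =>
    apply_nonneg_of_conservative hT hcons (hδ0 y) (hδ1 y)
  have hfin : ∀ s : Finset X, ∑ y ∈ s, T (delta y) x ≤ 1 := fun s => by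
    have hn : ‖∑ y ∈ s, (1 : ℝ) • delta y‖ ≤ 1 := norm_le_of_forall zero_le_one fun z => by
      rw [sum_smul_delta_apply s (fun _ => (1 : ℝ))]
      split_ifs <;> simp
    have h1 := (le_abs_self _).trans ((abs_apply_le_norm (T (∑ y ∈ s, (1 : ℝ) • delta y)) x).trans
      ((hT _).trans hn))
    simpa [DiscreteC0.sum_apply] using h1
  have hsum : Summable fun y => T (delta y) x := summable_of_sum_le h0 hfin
  have hone : ∑' y, T (delta y) x = 1 := by
    refine le_antisymm (hsum.tsum_le_of_sum_le hfin) (le_of_forall_pos_le_add fun δ hδ => ?_)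
    obtain ⟨h, hh0, hh1, hh⟩ := hcons δ hδ
    have := hasSum_le (fun y => mul_le_of_le_one_left (h0 y) (hh1 y)) (hasSum_apply_delta T x h)
      hsum.hasSum
    linarith
  refine ⟨⟨fun y => ENNReal.ofReal (T (delta y) x), ?_⟩, fun y => ENNReal.toReal_ofReal (h0 y)⟩
  rw [← ENNReal.ofReal_one, ← hone, ENNReal.ofReal_tsum_of_nonneg h0 hsum]
  exact ENNReal.summable.hasSum

theorem exists_kernel [MeasurableSpace X] [MeasurableSingletonClass X] [Countable X]
    (T : C₀(X, ℝ) →L[ℝ] C₀(X, ℝ)) (hT : ∀ f, ‖T f‖ ≤ ‖f‖)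
    (hcons : ∀ x, ∀ δ : ℝ, 0 < δ →
      ∃ h : C₀(X, ℝ), (∀ y, 0 ≤ h y) ∧ (∀ y, h y ≤ 1) ∧ 1 - δ ≤ T h x) :
    ∃ κ : Kernel X X, IsMarkovKernel κ ∧ ∀ (f : C₀(X, ℝ)) (x : X), T f x = ∫ y, f y ∂(κ x) := by
  choose p hp using fun x => exists_pmf T hT x (hcons x)
  refine ⟨Kernel.ofFunOfCountable fun x => (p x).toMeasure,
    ⟨fun x => PMF.toMeasure.isProbabilityMeasure (p x)⟩, fun f x => ?_⟩
  change T f x = ∫ y, f y ∂(p x).toMeasure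
  have hint : Integrable (fun y => f y) (p x).toMeasure :=
    Integrable.of_bound (measurable_of_countable _).aestronglyMeasurable ‖f‖
      (Eventually.of_forall fun y => abs_apply_le_norm f y)
  rw [PMF.integral_eq_tsum _ _ hint, ← (hasSum_apply_delta T x f).tsum_eq]
  exact tsum_congr fun y => by rw [hp, smul_eq_mul, mul_comm]

/-- A jump process with a Lyapunov function has a Feller semigroup, generated by the maximal
operator. -/
theorem exists_fellerSemigroup [MeasurableSpace X] [MeasurableSingletonClass X] [Countable X]
    (hq : ∀ x i, 0 ≤ q x i) (hσ : ∀ y, {x | ∃ i, σ x i = y}.Finite) (hφ : IsLyapunov q σ φ C) :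
    ∃ P : ℝ≥0 → (C₀(X, ℝ) →L[ℝ] C₀(X, ℝ)),
      IsFellerSemigroup P ∧ generator P = maximalOperator (jumpOp q σ) := by
  obtain ⟨P, hzero, hadd, hcontr, hcont, hlip, hgen⟩ := HilleYosida.exists_semigroup
    (dense_domain hσ) (dissipative_maximalOperator hq) fun c hc g => exists_solution hφ hq hc g
  refine ⟨P, ⟨hzero, hadd, hcont, fun t => exists_kernel (P t) (hcontr t) fun x δ hδ => ?_⟩, ?_⟩
  -- By ‖P(t)h - h‖ ≤ t‖Dh‖ this expression is a lower bound for P(t)h at x, where h is the barrier.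
  · have h1 : Tendsto (fun ε : ℝ => barrier φ ε x - t * (2 * |C| * ε)) (𝓝[>] 0) (𝓝 1) := by
      have h2 : Tendsto (fun ε : ℝ => t * (2 * |C| * ε)) (𝓝 0) (𝓝 0) := by
        have : Continuous fun ε : ℝ => t * (2 * |C| * ε) := by fun_prop
        simpa using this.tendsto 0
      have h3 := (IsLyapunov.tendsto_barrier (φ := φ) x).sub h2
      rw [sub_zero] at h3
      exact h3.mono_left nhdsWithin_le_nhds
    obtain ⟨ε, hε, hε0, hε1⟩ := ((h1.eventually (lt_mem_nhds (show 1 - δ < 1 by linarith))).and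
      (Ioc_mem_nhdsGT one_pos)).exists
    obtain ⟨h, hh, hD⟩ := exists_barrier_mem_domain hφ hq hε0 hε1
    refine ⟨h, fun y => ?_, fun y => ?_, ?_⟩
    · rw [hh]
      exact (hφ.barrier_pos hε0.le y).le
    · rw [hh]
      exact hφ.barrier_le_one hε0.le y
    · have h4 := (abs_apply_le_norm (P t h - (h : C₀(X, ℝ))) x).trans ((hlip t h).trans
        (mul_le_mul_of_nonneg_left hD t.coe_nonneg))
      rw [ZeroAtInftyContinuousMap.sub_apply, hh] at h4
      linarith [(abs_le.1 h4).1]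
  · have hdom : ∀ f g, IsGeneratorValue P f g ↔
        ∃ h : f ∈ (maximalOperator (jumpOp q σ)).domain,
          maximalOperator (jumpOp q σ) ⟨f, h⟩ = g := hgen
    refine LinearPMap.ext (Submodule.ext fun f => ⟨?_, fun h => ?_⟩) fun f hf hf' => ?_
    · rintro ⟨g, hg⟩
      exact ((hdom f g).1 hg).1
    · exact ⟨_, (hdom f _).2 ⟨h, rfl⟩⟩
    · exact (Classical.choose_spec hf).unique ((hdom f _).2 ⟨hf', rfl⟩)

end JumpProcess

/-! ### Sums of divided differences of monomials -/

namespace DividedDifference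

variable {ι : Type*} [DecidableEq ι]

/-- The divided difference of `t ↦ t ^ m` at the nodes `x k`, `k ∈ T`. -/
noncomputable def divDiff (x : ι → ℝ) (T : Finset ι) (m : ℕ) : ℝ :=
  ∑ k ∈ T, x k ^ m * ∏ j ∈ T.erase k, (x k - x j)⁻¹

variable {x : ι → ℝ}

/-- Write x_k = x_i + (x_k - x_i): the second summand cancels the pole at node i. -/
theorem divDiff_succ (hx : Function.Injective x) {T : Finset ι} {i : ι} (hi : i ∈ T) (m : ℕ) :
    divDiff x T (m + 1) = x i * divDiff x T m + divDiff x (T.erase i) m := by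
  have h1 : divDiff x T (m + 1) - x i * divDiff x T m
      = ∑ k ∈ T, (x k - x i) * (x k ^ m * ∏ j ∈ T.erase k, (x k - x j)⁻¹) := by
    rw [divDiff, divDiff, Finset.mul_sum, ← Finset.sum_sub_distrib]
    exact Finset.sum_congr rfl fun k _ => by ring
  rw [← sub_eq_iff_eq_add', h1, ← Finset.add_sum_erase _ _ hi, sub_self, zero_mul, zero_add,
    divDiff]
  refine Finset.sum_congr rfl fun k hk => ?_
  have hki : k ≠ i := Finset.ne_of_mem_erase hk
  rw [← Finset.mul_prod_erase (T.erase k) _ (Finset.mem_erase.2 ⟨hki.symm, hi⟩),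
    Finset.erase_right_comm]
  have : x k - x i ≠ 0 := sub_ne_zero.2 (hx.ne hki)
  field_simp

theorem divDiff_zero (hx : Function.Injective x) (n : ℕ) (T : Finset ι) (hT : T.card = n) :
    divDiff x T 0 = if n = 1 then 1 else 0 := by
  induction n generalizing T with
  | zero => simp [Finset.card_eq_zero.1 hT, divDiff]
  | succ n ih =>
    rcases Nat.eq_zero_or_pos n with rfl | hn
    · obtain ⟨a, rfl⟩ := Finset.card_eq_one.1 hT
      simp [divDiff]
    · rw [if_neg (by omega)]
      obtain ⟨i, hi, j, hj, hij⟩ := Finset.one_lt_card.1 (show 1 < T.card by omega)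
      have h1 := divDiff_succ hx hi 0
      have h2 := divDiff_succ hx hj 0
      rw [ih (T.erase i) (by rw [Finset.card_erase_of_mem hi]; omega)] at h1
      rw [ih (T.erase j) (by rw [Finset.card_erase_of_mem hj]; omega)] at h2
      have h3 : (x i - x j) * divDiff x T 0 = 0 := by linarith
      exact (mul_eq_zero.1 h3).resolve_left (sub_ne_zero.2 (hx.ne hij))

/-- The divided difference is a polynomial of degree m - |T| + 1 in the nodes (zero if this is
negative), so their separation plays no role. Keeping the power of M on the left avoids negative
exponents. -/
theorem abs_divDiff_mul_pow_le (hx : Function.Injective x) {M : ℝ} (hM : 1 ≤ M)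
    (hxM : ∀ k, |x k| ≤ M) (m : ℕ) (T : Finset ι) :
    |divDiff x T m| * M ^ (T.card - 1) ≤ 2 ^ m * M ^ m := by
  have hM0 : 0 < M := by linarith
  induction m generalizing T with
  | zero =>
    rw [divDiff_zero hx _ T rfl]
    split_ifs with h <;> simp [h]
  | succ m ih =>
    rcases T.eq_empty_or_nonempty with rfl | ⟨i, hi⟩
    · simp only [divDiff, Finset.sum_empty, abs_zero, zero_mul]
      positivity
    have h1 : |divDiff x T (m + 1)| ≤ M * |divDiff x T m| + |divDiff x (T.erase i) m| := by
      rw [divDiff_succ hx hi]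
      refine (abs_add_le _ _).trans ?_
      rw [abs_mul]
      gcongr
      exact hxM i
    have h2 : |divDiff x (T.erase i) m| * M ^ (T.card - 1) ≤ M * (2 ^ m * M ^ m) := by
      rcases (T.erase i).eq_empty_or_nonempty with h | h
      · rw [h]
        simp only [divDiff, Finset.sum_empty, abs_zero, zero_mul]
        positivity
      · have hc := Finset.card_erase_of_mem hi
        have hpos := h.card_pos
        rw [show T.card - 1 = (T.erase i).card - 1 + 1 by omega, pow_succ, ← mul_assoc, mul_comm M]
        exact mul_le_mul_of_nonneg_right (ih _) hM0.le
    calc |divDiff x T (m + 1)| * M ^ (T.card - 1)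
        ≤ (M * |divDiff x T m| + |divDiff x (T.erase i) m|) * M ^ (T.card - 1) := by gcongr
      _ = M * (|divDiff x T m| * M ^ (T.card - 1))
          + |divDiff x (T.erase i) m| * M ^ (T.card - 1) := by ring
      _ ≤ M * (2 ^ m * M ^ m) + M * (2 ^ m * M ^ m) :=
        add_le_add (mul_le_mul_of_nonneg_left (ih T) hM0.le) h2
      _ = 2 ^ (m + 1) * M ^ (m + 1) := by ring

variable [Fintype ι]

/-- The sum `∑ k, x_k ^ m ∏_{j ≠ k} (1 + s / (x_k - x_j))`. -/
noncomputable def shiftSum (x : ι → ℝ) (s : ℝ) (m : ℕ) : ℝ :=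
  ∑ k, x k ^ m * ∏ j ∈ Finset.univ.erase k, (1 + s * (x k - x j)⁻¹)

/-- Expand each product over subsets S of the other indices and regroup by T = S ∪ {k}. The empty T
contributes 0, so truncation in `T.card - 1` is harmless. -/
theorem shiftSum_eq (x : ι → ℝ) (s : ℝ) (m : ℕ) :
    shiftSum x s m = ∑ T : Finset ι, s ^ (T.card - 1) * divDiff x T m := by
  have h1 : ∀ T : Finset ι, s ^ (T.card - 1) * divDiff x T m
      = ∑ k ∈ T, x k ^ m * ∏ j ∈ T.erase k, s * (x k - x j)⁻¹ := fun T => by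
    rw [divDiff, Finset.mul_sum]
    refine Finset.sum_congr rfl fun k hk => ?_
    rw [Finset.prod_mul_distrib, Finset.prod_const, Finset.card_erase_of_mem hk]
    ring
  simp_rw [h1]
  rw [Finset.sum_comm' (t' := Finset.univ) (s' := fun k => Finset.univ.filter fun T => k ∈ T)
    (by simp), shiftSum]
  refine Finset.sum_congr rfl fun k _ => ?_
  rw [Finset.prod_one_add, Finset.mul_sum]
  refine Finset.sum_nbij' (fun S => insert k S) (fun T => T.erase k) ?_ ?_ ?_ ?_ ?_
  · simp
  · intro T _
    exact Finset.mem_powerset.2 (Finset.erase_subset_erase k (Finset.subset_univ T))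
  · intro S hS
    exact Finset.erase_insert fun h =>
      Finset.notMem_erase k _ (Finset.mem_powerset.1 hS h)
  · intro T hT
    exact Finset.insert_erase (Finset.mem_filter.1 hT).2
  · intro S hS
    rw [Finset.erase_insert fun h => Finset.notMem_erase k _ (Finset.mem_powerset.1 hS h)]

theorem abs_shiftSum_le (hx : Function.Injective x) {M : ℝ} (hM : 1 ≤ M)
    (hxM : ∀ k, |x k| ≤ M) {s : ℝ} (hs : |s| ≤ 1) (m : ℕ) :
    |shiftSum x s m| ≤ 2 ^ Fintype.card ι * (2 ^ m * M ^ m) := by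
  rw [shiftSum_eq]
  refine (Finset.abs_sum_le_sum_abs _ _).trans
    ((Finset.sum_le_card_nsmul _ _ (2 ^ m * M ^ m) fun T _ => ?_).trans_eq ?_)
  · rw [abs_mul, abs_pow]
    refine (mul_le_of_le_one_left (abs_nonneg _) (pow_le_one₀ (abs_nonneg s) hs)).trans
      (le_trans ?_ (abs_divDiff_mul_pow_le hx hM hxM m T))
    exact le_mul_of_one_le_right (abs_nonneg _) (one_le_pow₀ hM)
  · simp

/-- The leading terms of the sums with `s = 1` and `s = -1` agree. -/
theorem abs_shiftSum_sub_le (hx : Function.Injective x) {M : ℝ} (hM : 1 ≤ M)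
    (hxM : ∀ k, |x k| ≤ M) (m : ℕ) :
    |shiftSum x 1 (m + 1) - shiftSum x (-1) (m + 1)|
      ≤ 2 ^ Fintype.card ι * (2 ^ (m + 2) * M ^ m) := by
  have hM0 : 0 < M := by linarith
  rw [shiftSum_eq, shiftSum_eq, ← Finset.sum_sub_distrib]
  refine (Finset.abs_sum_le_sum_abs _ _).trans
    ((Finset.sum_le_card_nsmul _ _ (2 ^ (m + 2) * M ^ m) fun T _ => ?_).trans_eq ?_)
  · rw [← sub_mul, abs_mul]
    -- For |T| ≤ 1 the two signs cancel; for larger T the divided difference has already lost a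
    -- degree.
    rcases Nat.lt_or_ge (T.card - 1) 1 with h | h
    · rw [show T.card - 1 = 0 by omega]
      simp only [pow_zero, sub_self, abs_zero, zero_mul]
      positivity
    · have h1 := abs_divDiff_mul_pow_le hx hM hxM (m + 1) T
      have h2 : |divDiff x T (m + 1)| * M ≤ |divDiff x T (m + 1)| * M ^ (T.card - 1) := by
        gcongr
        exact le_self_pow₀ hM (by omega)
      have h3 : |divDiff x T (m + 1)| ≤ 2 ^ (m + 1) * M ^ m := by
        refine le_of_mul_le_mul_right ?_ hM0
        rw [mul_assoc, ← pow_succ]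
        exact h2.trans h1
      have h4 : |(1 : ℝ) ^ (T.card - 1) - (-1) ^ (T.card - 1)| ≤ 2 := by
        refine (abs_sub _ _).trans ?_
        rw [abs_pow, abs_pow, abs_neg, abs_one, one_pow]
        norm_num
      calc _ ≤ 2 * (2 ^ (m + 1) * M ^ m) := by gcongr
        _ = _ := by ring
  · simp

end DividedDifference

/-! ### The difference operator as a jump operator -/

namespace FellerZW

open JumpProcess DividedDifference

variable {N : ℕ}

theorem vandermonde_eq_zero {n : Fin N → ℤ} {i j : Fin N} (hij : i < j) (h : n i = n j) :
    vandermonde n = 0 :=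
  Finset.prod_eq_zero (Finset.mem_univ i) (Finset.prod_eq_zero (Finset.mem_Ioi.2 hij) (by
    rw [h, sub_self]))

/-- A unit step can leave the strictly decreasing tuples only by making two coordinates equal. -/
theorem vandermonde_add_single_eq_zero {n : Fin N → ℤ} (hn : StrictAnti n) {k : Fin N}
    (h : ¬ StrictAnti (n + Pi.single k 1)) : vandermonde (n + Pi.single k 1) = 0 := by
  simp only [StrictAnti, not_forall, not_lt] at h
  obtain ⟨i, j, hij, h⟩ := h
  refine vandermonde_eq_zero hij ?_
  have := hn hij
  simp only [Pi.add_apply, Pi.single_apply] at h ⊢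
  split_ifs at h ⊢ <;> omega

theorem vandermonde_sub_single_eq_zero {n : Fin N → ℤ} (hn : StrictAnti n) {k : Fin N}
    (h : ¬ StrictAnti (n - Pi.single k 1)) : vandermonde (n - Pi.single k 1) = 0 := by
  simp only [StrictAnti, not_forall, not_lt] at h
  obtain ⟨i, j, hij, h⟩ := h
  refine vandermonde_eq_zero hij ?_
  have := hn hij
  simp only [Pi.sub_apply, Pi.single_apply] at h ⊢
  split_ifs at h ⊢ <;> omega

theorem prod_Ioi_eq_prod_erase (k : Fin N) (u : Fin N → ℝ) :
    ∏ i : Fin N, ∏ j ∈ Finset.Ioi i, (if i = k then u j else if j = k then u i else 1)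
      = ∏ j ∈ Finset.univ.erase k, u j := by
  have h1 : ∀ i : Fin N, i ≠ k →
      ∏ j ∈ Finset.Ioi i, (if i = k then u j else if j = k then u i else 1)
        = if i < k then u i else 1 := fun i hi => by
    simp only [if_neg hi]
    rw [Finset.prod_ite_eq']
    simp
  rw [← Finset.mul_prod_erase _ _ (Finset.mem_univ k),
    Finset.prod_congr rfl fun i hi => h1 i (Finset.ne_of_mem_erase hi), ← Finset.prod_filter]
  have h2 : (Finset.univ.erase k).filter (· < k) = (Finset.univ.erase k).filter fun j => ¬ k < j := by
    ext j
    simp only [Finset.mem_filter, Finset.mem_erase, Finset.mem_univ, and_true, not_lt,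
      and_congr_right_iff]
    exact fun h => ⟨le_of_lt, fun h' => lt_of_le_of_ne h' h⟩
  have h3 : Finset.Ioi k = (Finset.univ.erase k).filter fun j => k < j := by
    ext j
    simp only [Finset.mem_filter, Finset.mem_erase, Finset.mem_univ, and_true, Finset.mem_Ioi]
    exact ⟨fun h => ⟨h.ne', h⟩, fun h => h.2⟩
  simp only [if_true]
  rw [h2, h3, Finset.prod_filter_mul_prod_filter_not]

theorem vandermonde_ratio {n m : Fin N → ℤ} (hn : StrictAnti n) {k : Fin N} {s : ℤ}
    (hm : ∀ i, m i = n i + if i = k then s else 0) :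
    vandermonde m / vandermonde n
      = ∏ j ∈ Finset.univ.erase k, (1 + (s : ℝ) * ((n k : ℝ) - n j)⁻¹) := by
  rw [← prod_Ioi_eq_prod_erase, vandermonde, vandermonde, ← Finset.prod_div_distrib]
  refine Finset.prod_congr rfl fun i _ => ?_
  rw [← Finset.prod_div_distrib]
  refine Finset.prod_congr rfl fun j hj => ?_
  have hij : i < j := Finset.mem_Ioi.1 hj
  have h1 : (n i : ℝ) - n j ≠ 0 := by
    have := hn hij
    exact sub_ne_zero.2 (by exact_mod_cast this.ne')
  have h2 : (n j : ℝ) - n i ≠ 0 := by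
    rw [← neg_sub]
    exact neg_ne_zero.2 h1
  rw [hm, hm]
  split_ifs with hi hj' hj'
  · exact absurd (hi.trans hj'.symm) hij.ne
  · subst hi
    push_cast
    field_simp
    ring
  · subst hj'
    push_cast
    field_simp
    ring
  · push_cast
    rw [add_zero, add_zero, div_self h1]

theorem vandermonde_add_ratio (n : Omega N) (k : Fin N) :
    vandermonde (n.1 + Pi.single k 1) / vandermonde n.1
      = ∏ j ∈ Finset.univ.erase k, (1 + (1 : ℝ) * ((n.1 k : ℝ) - n.1 j)⁻¹) := by
  simpa using vandermonde_ratio (s := 1) n.2 (m := n.1 + Pi.single k 1) (k := k) fun i => by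
    rw [Pi.add_apply, Pi.single_apply]

theorem vandermonde_sub_ratio (n : Omega N) (k : Fin N) :
    vandermonde (n.1 - Pi.single k 1) / vandermonde n.1
      = ∏ j ∈ Finset.univ.erase k, (1 + (-1 : ℝ) * ((n.1 k : ℝ) - n.1 j)⁻¹) := by
  simpa using vandermonde_ratio (s := -1) n.2 (m := n.1 - Pi.single k 1) (k := k) fun i => by
    rw [Pi.sub_apply, Pi.single_apply]
    split_ifs <;> ring

/-- Distinct integers differ by at least 1, so every factor lies in [0, 2]. -/
theorem prod_shift_nonneg (n : Omega N) (k : Fin N) {s : ℝ} (hs : |s| ≤ 1) :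
    0 ≤ ∏ j ∈ Finset.univ.erase k, (1 + s * ((n.1 k : ℝ) - n.1 j)⁻¹) ∧
      ∏ j ∈ Finset.univ.erase k, (1 + s * ((n.1 k : ℝ) - n.1 j)⁻¹) ≤ 2 ^ N := by
  have h : ∀ j ∈ Finset.univ.erase k, |s * ((n.1 k : ℝ) - n.1 j)⁻¹| ≤ 1 := fun j hj => by
    rw [abs_mul, abs_inv]
    refine mul_le_one₀ hs (by positivity) (inv_le_one_of_one_le₀ ?_)
    have h1 : n.1 k - n.1 j ≠ 0 := sub_ne_zero.2 (n.2.injective.ne (Finset.ne_of_mem_erase hj).symm)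
    exact_mod_cast Int.one_le_abs h1
  have h0 : ∀ j ∈ Finset.univ.erase k, 0 ≤ 1 + s * ((n.1 k : ℝ) - n.1 j)⁻¹ := fun j hj => by
    linarith [neg_abs_le (s * ((n.1 k : ℝ) - n.1 j)⁻¹), h j hj]
  refine ⟨Finset.prod_nonneg h0, ?_⟩
  calc _ ≤ ∏ j ∈ Finset.univ.erase k, (2 : ℝ) := Finset.prod_le_prod h0 fun j hj => by
        linarith [le_abs_self (s * ((n.1 k : ℝ) - n.1 j)⁻¹), h j hj]
    _ = 2 ^ (Finset.univ.erase k).card := Finset.prod_const _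
    _ ≤ 2 ^ N := pow_le_pow_right₀ one_le_two (by
        simp)

/-- The real number `(Z - x) (Z' - x)` for real `x` is a monic quadratic polynomial in `x`. -/
theorem re_sub_mul_sub (Z Z' : ℂ) (x : ℤ) :
    ((Z - x) * (Z' - x)).re = (x : ℝ) ^ 2 + -(Z + Z').re * x + (Z * Z').re := by
  simp only [Complex.mul_re, Complex.sub_re, Complex.sub_im, Complex.intCast_re,
    Complex.intCast_im, Complex.add_re]
  ring

theorem re_add_mul_add (W W' : ℂ) (x : ℤ) :
    ((W + x) * (W' + x)).re = (x : ℝ) ^ 2 + (W + W').re * x + (W * W').re := by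
  simp only [Complex.mul_re, Complex.add_re, Complex.add_im, Complex.intCast_re,
    Complex.intCast_im]
  ring

/-- The jump rates, for the jumps `n ↦ n + ε_k` on the left and `n ↦ n - ε_k` on the right. -/
noncomputable def jumpRate (z z' w w' : ℂ) (n : Omega N) : Fin N ⊕ Fin N → ℝ :=
  Sum.elim (upRate z z' n) (downRate w w' n)

/-- The displacements `± ε_k`. -/
def displacement : Fin N ⊕ Fin N → (Fin N → ℤ) :=
  Sum.elim (fun k => Pi.single k 1) (fun k => -Pi.single k 1)

open scoped Classical in
/-- The targets of the jumps; a jump leaving `Ω_N` is replaced by no jump. -/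
noncomputable def jumpTarget (n : Omega N) (i : Fin N ⊕ Fin N) : Omega N :=
  if h : StrictAnti (n.1 + displacement i) then ⟨n.1 + displacement i, h⟩ else n

variable {z z' w w' : ℂ}

theorem jumpRate_eq_zero (n : Omega N) (i : Fin N ⊕ Fin N)
    (h : ¬ StrictAnti (n.1 + displacement i)) : jumpRate z z' w w' n i = 0 := by
  rcases i with k | k
  · simp only [jumpRate, Sum.elim_inl, upRate]
    rw [vandermonde_add_single_eq_zero n.2 h, zero_div, zero_mul]
  · simp only [jumpRate, Sum.elim_inr, downRate]
    rw [vandermonde_sub_single_eq_zero n.2 (by rwa [sub_eq_add_neg]), zero_div, zero_mul]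

theorem jumpRate_nonneg (hadm : Admissible z z' w w') (n : Omega N) (i : Fin N ⊕ Fin N) :
    0 ≤ jumpRate z z' w w' n i := by
  rcases i with k | k
  · refine mul_nonneg ?_ ?_
    · rw [vandermonde_add_ratio]
      exact (prod_shift_nonneg n k (by simp)).1
    · have := (hadm.z_pos (N - 1 - n.1 k)).1.le
      push_cast at this
      convert this using 3 <;> ring
  · refine mul_nonneg ?_ ?_
    · rw [vandermonde_sub_ratio]
      exact (prod_shift_nonneg n k (by simp)).1
    · exact (hadm.w_pos (n.1 k)).1.le

/-- The two sides treat exits from `Omega N` differently (value 0 against staying put), but such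
jumps have rate zero. -/
theorem diffOp_eq_jumpOp :
    diffOp N z z' w w' = jumpOp (jumpRate z z' w w') jumpTarget := by
  refine LinearMap.ext fun f => funext fun n => ?_
  have h : ∀ i : Fin N ⊕ Fin N, jumpRate z z' w w' n i * (f (jumpTarget n i) - f n)
      = jumpRate z z' w w' n i * (valueAt f (n.1 + displacement i) - f n) := fun i => by
    by_cases hi : StrictAnti (n.1 + displacement i)
    · rw [jumpTarget, valueAt, dif_pos hi, dif_pos hi]
    · rw [jumpRate_eq_zero n i hi, zero_mul, zero_mul]
  rw [jumpOp_apply, Finset.sum_congr rfl fun i _ => h i, Fintype.sum_sum_type,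
    ← Finset.sum_add_distrib]
  change ∑ k : Fin N, (upRate z z' n k * (valueAt f (n.1 + Pi.single k 1) - f n) +
    downRate w w' n k * (valueAt f (n.1 - Pi.single k 1) - f n)) = _
  refine Finset.sum_congr rfl fun k _ => ?_
  simp only [jumpRate, displacement, Sum.elim_inl, Sum.elim_inr, sub_eq_add_neg]

/-! ### The quadratic Lyapunov function -/

/-- The function `1 + ∑ k, n_k²`. -/
noncomputable def quadratic (n : Omega N) : ℝ := 1 + ∑ k, (n.1 k : ℝ) ^ 2

theorem one_le_quadratic (n : Omega N) : 1 ≤ quadratic n :=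
  le_add_of_nonneg_right (Finset.sum_nonneg fun _ _ => sq_nonneg _)

theorem sq_add_one_le_quadratic (n : Omega N) (k : Fin N) :
    (n.1 k : ℝ) ^ 2 + 1 ≤ quadratic n := by
  have : (n.1 k : ℝ) ^ 2 ≤ ∑ k, (n.1 k : ℝ) ^ 2 :=
    Finset.single_le_sum (f := fun k => (n.1 k : ℝ) ^ 2) (fun _ _ => sq_nonneg _)
      (Finset.mem_univ k)
  simp only [quadratic]
  linarith

theorem finite_quadratic_le (c : ℝ) : {n : Omega N | quadratic n ≤ c}.Finite := by
  refine ((Set.finite_Icc (fun _ : Fin N => -⌊c⌋) (fun _ => ⌊c⌋)).preimage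
    Subtype.val_injective.injOn).subset fun n hn => ?_
  have h : ∀ k, |n.1 k| ≤ ⌊c⌋ := fun k => by
    rw [Int.le_floor]
    have h1 := (sq_add_one_le_quadratic n k).trans hn
    push_cast
    rw [← sq_abs] at h1
    nlinarith [sq_nonneg (|(n.1 k : ℝ)| - 1)]
  exact ⟨fun k => (abs_le.1 (h k)).1, fun k => (abs_le.1 (h k)).2⟩

/-- The coordinate changed by a jump. -/
def jumpIndex : Fin N ⊕ Fin N → Fin N := Sum.elim id id

/-- The sign of a jump. -/
noncomputable def jumpSign : Fin N ⊕ Fin N → ℝ := Sum.elim (fun _ => 1) (fun _ => -1)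

theorem quadratic_jumpTarget (n : Omega N) (i : Fin N ⊕ Fin N)
    (h : StrictAnti (n.1 + displacement i)) :
    quadratic (jumpTarget n i) = quadratic n + 2 * jumpSign i * n.1 (jumpIndex i) + 1 := by
  have key : ∀ (k : Fin N) (d : Fin N → ℤ) (s : ℝ), s ^ 2 = 1 →
      (∀ j, (d j : ℝ) = if j = k then s else 0) →
      1 + ∑ j, (((n.1 + d) j : ℤ) : ℝ) ^ 2 = quadratic n + 2 * s * n.1 k + 1 := by
    intro k d s hs hd
    have e : ∀ j, (((n.1 + d) j : ℤ) : ℝ) ^ 2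
        = (n.1 j : ℝ) ^ 2 + if j = k then 2 * s * n.1 j + 1 else 0 := fun j => by
      rw [Pi.add_apply, Int.cast_add, hd]
      split_ifs
      · rw [← hs]
        ring
      · ring
    simp_rw [e]
    rw [Finset.sum_add_distrib, Finset.sum_ite_eq', if_pos (Finset.mem_univ k), quadratic]
    ring
  rw [jumpTarget, dif_pos h, quadratic]
  rcases i with k | k
  · exact key k _ 1 (by norm_num) fun j => by
      simp only [displacement, Sum.elim_inl, Pi.single_apply]
      split_ifs <;> simp
  · exact key k _ (-1) (by norm_num) fun j => by
      simp only [displacement, Sum.elim_inr, Pi.neg_apply, Pi.single_apply]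
      split_ifs <;> simp

/-- Serves both the passage to the logarithm and the finiteness of the set of states jumping to a
given one. -/
theorem quadratic_le_jumpTarget (n : Omega N) (i : Fin N ⊕ Fin N) :
    quadratic n ≤ 3 * quadratic (jumpTarget n i) := by
  by_cases h : StrictAnti (n.1 + displacement i)
  · rw [quadratic_jumpTarget n i h]
    have h1 := sq_add_one_le_quadratic n (jumpIndex i)
    have h2 : jumpSign i ^ 2 = 1 := by rcases i with k | k <;> simp [jumpSign]
    nlinarith [sq_nonneg (2 * (n.1 (jumpIndex i) : ℝ) + 3 * jumpSign i)]
  · rw [jumpTarget, dif_neg h]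
    linarith [one_le_quadratic n]

theorem finite_jumpTarget_eq (y : Omega N) : {x | ∃ i, jumpTarget x i = y}.Finite :=
  (finite_quadratic_le (3 * quadratic y)).subset fun x ⟨i, hi⟩ => hi ▸ quadratic_le_jumpTarget x i

theorem jumpRate_mul_quadratic_sub (n : Omega N) (i : Fin N ⊕ Fin N) :
    jumpRate z z' w w' n i * (quadratic (jumpTarget n i) - quadratic n)
      = jumpRate z z' w w' n i * (2 * jumpSign i * n.1 (jumpIndex i) + 1) := by
  by_cases h : StrictAnti (n.1 + displacement i)
  · rw [quadratic_jumpTarget n i h]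
    ring
  · rw [jumpRate_eq_zero n i h, zero_mul, zero_mul]

theorem jumpRate_mul_quadratic_sub_sq (n : Omega N) (i : Fin N ⊕ Fin N) :
    jumpRate z z' w w' n i * (quadratic (jumpTarget n i) - quadratic n) ^ 2
      = jumpRate z z' w w' n i * (2 * jumpSign i * n.1 (jumpIndex i) + 1) ^ 2 := by
  rw [sq, ← mul_assoc, jumpRate_mul_quadratic_sub, mul_right_comm, jumpRate_mul_quadratic_sub]
  ring

end FellerZW

/-! ### Drift and energy of the quadratic function -/

namespace FellerZW

open JumpProcess DividedDifference

variable {N : ℕ} {z z' w w' : ℂ}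

theorem upRate_eq (z z' : ℂ) (n : Omega N) (k : Fin N) :
    upRate z z' n k = (∏ j ∈ Finset.univ.erase k, (1 + (1 : ℝ) * ((n.1 k : ℝ) - n.1 j)⁻¹)) *
      ((n.1 k : ℝ) ^ 2 + -((z + N - 1) + (z' + N - 1)).re * n.1 k
        + ((z + N - 1) * (z' + N - 1)).re) := by
  rw [upRate, vandermonde_add_ratio, re_sub_mul_sub]

theorem downRate_eq (w w' : ℂ) (n : Omega N) (k : Fin N) :
    downRate w w' n k = (∏ j ∈ Finset.univ.erase k, (1 + (-1 : ℝ) * ((n.1 k : ℝ) - n.1 j)⁻¹)) *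
      ((n.1 k : ℝ) ^ 2 + (w + w').re * n.1 k + (w * w').re) := by
  rw [downRate, vandermonde_sub_ratio, re_add_mul_add]

theorem abs_le_sqrt_quadratic (n : Omega N) (k : Fin N) : |(n.1 k : ℝ)| ≤ √(quadratic n) :=
  Real.abs_le_sqrt (by linarith [sq_add_one_le_quadratic n k])

theorem one_le_sqrt_quadratic (n : Omega N) : 1 ≤ √(quadratic n) :=
  Real.one_le_sqrt.2 (one_le_quadratic n)

theorem injective_intCast (n : Omega N) : Function.Injective fun k => (n.1 k : ℝ) :=
  Int.cast_injective.comp n.2.injective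

/-- Multiply out (x² + ax + b)(2x + 1) and (x² + cx + d)(-2x + 1); the cubic terms have opposite
signs and pair into a difference of shift sums. -/
theorem jumpOp_quadratic (n : Omega N) {a b c d : ℝ}
    (ha : a = -((z + N - 1) + (z' + N - 1)).re) (hb : b = ((z + N - 1) * (z' + N - 1)).re)
    (hc : c = (w + w').re) (hd : d = (w * w').re) {S : ℝ → ℕ → ℝ}
    (hS : S = shiftSum fun k => (n.1 k : ℝ)) :
    jumpOp (jumpRate z z' w w') jumpTarget quadratic n
      = 2 * (S 1 3 - S (-1) 3) + ((2 * a + 1) * S 1 2 + (2 * b + a) * S 1 1 + b * S 1 0)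
        + ((1 - 2 * c) * S (-1) 2 + (c - 2 * d) * S (-1) 1 + d * S (-1) 0) := by
  rw [jumpOp_apply, Finset.sum_congr rfl fun i _ => jumpRate_mul_quadratic_sub n i,
    Fintype.sum_sum_type]
  simp only [jumpRate, jumpSign, jumpIndex, Sum.elim_inl, Sum.elim_inr, id, upRate_eq,
    downRate_eq, ← ha, ← hb, ← hc, ← hd, hS, shiftSum]
  simp only [mul_sub, Finset.mul_sum, ← Finset.sum_sub_distrib, ← Finset.sum_add_distrib]
  exact Finset.sum_congr rfl fun k _ => by ring

theorem exists_abs_jumpOp_quadratic_le (N : ℕ) (z z' w w' : ℂ) : ∃ C : ℝ, 0 ≤ C ∧ ∀ n : Omega N,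
    |jumpOp (jumpRate z z' w w') jumpTarget quadratic n| ≤ C * quadratic n := by
  obtain ⟨a, ha⟩ : ∃ a : ℝ, a = -((z + N - 1) + (z' + N - 1)).re := ⟨_, rfl⟩
  obtain ⟨b, hb⟩ : ∃ b : ℝ, b = ((z + N - 1) * (z' + N - 1)).re := ⟨_, rfl⟩
  obtain ⟨c, hc⟩ : ∃ c : ℝ, c = (w + w').re := ⟨_, rfl⟩
  obtain ⟨d, hd⟩ : ∃ d : ℝ, d = (w * w').re := ⟨_, rfl⟩
  -- With M = √ψ every sum of degree at most 2, and the cubic difference, is at most 2^N · 16 · ψ;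
  -- here 16 = 2^(m+2) at m = 2.
  refine ⟨2 ^ N * 16 * (2 + |2 * a + 1| + |2 * b + a| + |b| + |1 - 2 * c| + |c - 2 * d| + |d|),
    by positivity, fun n => ?_⟩
  have hM := one_le_sqrt_quadratic n
  have hx := injective_intCast n
  have hxM := abs_le_sqrt_quadratic n
  have hsq : √(quadratic n) ^ 2 = quadratic n :=
    Real.sq_sqrt (zero_le_one.trans (one_le_quadratic n))
  obtain ⟨S, hS⟩ : ∃ S : ℝ → ℕ → ℝ, S = shiftSum fun k => (n.1 k : ℝ) := ⟨_, rfl⟩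
  have h3 : |S 1 3 - S (-1) 3| ≤ 2 ^ N * 16 * quadratic n := by
    have := abs_shiftSum_sub_le hx hM hxM 2
    rw [hS, mul_assoc]
    norm_num [hsq] at this ⊢
    exact this
  have hlow : ∀ s : ℝ, |s| ≤ 1 → ∀ m ≤ 2, |S s m| ≤ 2 ^ N * 16 * quadratic n := by
    intro s hs m hm
    have h1 := abs_shiftSum_le hx hM hxM hs m
    rw [Fintype.card_fin] at h1
    rw [hS, mul_assoc]
    refine h1.trans (mul_le_mul_of_nonneg_left ?_ (by positivity))
    refine (mul_le_mul (b := 16) ?_ (pow_le_pow_right₀ hM hm) (by positivity)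
      (by norm_num)).trans_eq (by rw [hsq])
    calc (2 : ℝ) ^ m ≤ 2 ^ 4 := pow_le_pow_right₀ one_le_two (by omega)
      _ = 16 := by norm_num
  have hmul : ∀ r : ℝ, ∀ s : ℝ, |s| ≤ 1 → ∀ m ≤ 2,
      |r * S s m| ≤ |r| * (2 ^ N * 16 * quadratic n) := fun r s hs m hm => by
    rw [abs_mul]
    exact mul_le_mul_of_nonneg_left (hlow s hs m hm) (abs_nonneg r)
  have e1 : |(1 : ℝ)| ≤ 1 := by simp
  have e2 : |(-1 : ℝ)| ≤ 1 := by simp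
  have b0 := abs_le.1 h3
  have b1 := abs_le.1 (hmul (2 * a + 1) 1 e1 2 le_rfl)
  have b2 := abs_le.1 (hmul (2 * b + a) 1 e1 1 one_le_two)
  have b3 := abs_le.1 (hmul b 1 e1 0 zero_le_two)
  have b4 := abs_le.1 (hmul (1 - 2 * c) (-1) e2 2 le_rfl)
  have b5 := abs_le.1 (hmul (c - 2 * d) (-1) e2 1 one_le_two)
  have b6 := abs_le.1 (hmul d (-1) e2 0 zero_le_two)
  rw [jumpOp_quadratic n ha hb hc hd hS, abs_le]
  constructor <;> linarith

theorem monic_quadratic_le {M x a b : ℝ} (hM : 1 ≤ M) (hx : |x| ≤ M) :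
    x ^ 2 + a * x + b ≤ (1 + |a| + |b|) * M ^ 2 := by
  have h1 : x ^ 2 ≤ M ^ 2 := sq_le_sq.2 (hx.trans (le_abs_self M))
  have h2 : a * x ≤ |a| * M ^ 2 := by
    refine (le_abs_self _).trans ?_
    rw [abs_mul]
    gcongr
    nlinarith
  have h3 : b ≤ |b| * M ^ 2 := (le_abs_self b).trans
    (le_mul_of_one_le_right (abs_nonneg b) (one_le_pow₀ hM))
  linarith

/-- No cancellation is needed: each rate is O(ψ), and each squared increment of a permitted jump is
at most 9ψ. -/
theorem exists_energy_quadratic_le (N : ℕ) (z z' w w' : ℂ) : ∃ C : ℝ, 0 ≤ C ∧ ∀ n : Omega N,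
    energy (jumpRate z z' w w') jumpTarget quadratic n ≤ C * quadratic n ^ 2 := by
  obtain ⟨A, hA0, hA⟩ : ∃ A : ℝ, 0 ≤ A ∧ ∀ (n : Omega N) (i : Fin N ⊕ Fin N),
      jumpRate z z' w w' n i ≤ 2 ^ N * A * quadratic n := by
    let a : ℝ := -((z + N - 1) + (z' + N - 1)).re
    let b : ℝ := ((z + N - 1) * (z' + N - 1)).re
    refine ⟨(1 + |a| + |b|) + (1 + |(w + w').re| + |(w * w').re|), by positivity, fun n i => ?_⟩
    have hM := one_le_sqrt_quadratic n
    have hsq : √(quadratic n) ^ 2 = quadratic n :=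
      Real.sq_sqrt (zero_le_one.trans (one_le_quadratic n))
    have hq : 0 ≤ quadratic n := zero_le_one.trans (one_le_quadratic n)
    have hmul : ∀ {p B r : ℝ}, 0 ≤ p → p ≤ 2 ^ N → 0 ≤ B → r ≤ B * quadratic n →
        p * r ≤ 2 ^ N * B * quadratic n := fun hp hp' hB hr => by
      rw [mul_assoc]
      exact (mul_le_mul_of_nonneg_left hr hp).trans
        (mul_le_mul_of_nonneg_right hp' (by positivity))
    have e : ∀ k, ∀ a b : ℝ, (n.1 k : ℝ) ^ 2 + a * n.1 k + b ≤ (1 + |a| + |b|) * quadratic n :=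
      fun k a b => by
        rw [← hsq]
        exact monic_quadratic_le hM (abs_le_sqrt_quadratic n k)
    rcases i with k | k
    · obtain ⟨h1, h2⟩ := prod_shift_nonneg n k (s := 1) (by simp)
      simp only [jumpRate, Sum.elim_inl]
      rw [upRate_eq]
      refine hmul h1 h2 (by positivity) ((e k _ _).trans ?_)
      exact mul_le_mul_of_nonneg_right (le_add_of_nonneg_right (by positivity)) hq
    · obtain ⟨h1, h2⟩ := prod_shift_nonneg n k (s := -1) (by simp)
      simp only [jumpRate, Sum.elim_inr]
      rw [downRate_eq]
      refine hmul h1 h2 (by positivity) ((e k _ _).trans ?_)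
      exact mul_le_mul_of_nonneg_right (le_add_of_nonneg_left (by positivity)) hq
  refine ⟨Fintype.card (Fin N ⊕ Fin N) * (2 ^ N * A * 9), by positivity, fun n => ?_⟩
  have hq : 0 ≤ quadratic n := zero_le_one.trans (one_le_quadratic n)
  rw [energy]
  refine (Finset.sum_le_card_nsmul _ _ (2 ^ N * A * 9 * quadratic n ^ 2) fun i _ => ?_).trans_eq ?_
  · rw [jumpRate_mul_quadratic_sub_sq]
    have h1 : (2 * jumpSign i * (n.1 (jumpIndex i) : ℝ) + 1) ^ 2 ≤ 9 * quadratic n := by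
      have h2 := sq_add_one_le_quadratic n (jumpIndex i)
      have h3 : jumpSign i ^ 2 = 1 := by rcases i with k | k <;> simp [jumpSign]
      nlinarith [sq_nonneg ((n.1 (jumpIndex i) : ℝ) - jumpSign i)]
    calc _ ≤ 2 ^ N * A * quadratic n * (9 * quadratic n) :=
          mul_le_mul (hA n i) h1 (sq_nonneg _) (by positivity)
      _ = _ := by ring
  · rw [nsmul_eq_mul, Finset.card_univ]
    ring

theorem exists_isLyapunov (hadm : Admissible z z' w w') (N : ℕ) : ∃ C : ℝ,
    IsLyapunov (jumpRate z z' w w') jumpTarget (fun n : Omega N => Real.log (quadratic n)) C := by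
  obtain ⟨C₁, h1, hC₁⟩ := exists_abs_jumpOp_quadratic_le N z z' w w'
  obtain ⟨C₂, h2, hC₂⟩ := exists_energy_quadratic_le N z z' w w'
  refine ⟨_, IsLyapunov.log (C := C₁ + C₂) (jumpRate_nonneg hadm) (by positivity) one_le_quadratic
    finite_quadratic_le (fun n => (hC₁ n).trans ?_) (fun n => (hC₂ n).trans ?_)
    quadratic_le_jumpTarget⟩
  · have := one_le_quadratic n
    gcongr
    linarith
  · gcongr
    linarith

end FellerZW

theorem theorem5 (z z' w w' : ℂ) (hadm : FellerZW.Admissible z z' w w') (N : ℕ) (hN : 1 ≤ N) :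
    ∃ P : ℝ≥0 → (C₀(FellerZW.Omega N, ℝ) →L[ℝ] C₀(FellerZW.Omega N, ℝ)),
      FellerZW.IsFellerSemigroup P ∧
        FellerZW.generator P =
          FellerZW.maximalOperator (FellerZW.diffOp N z z' w w') := by
  obtain ⟨C, hC⟩ := FellerZW.exists_isLyapunov hadm N
  rw [FellerZW.diffOp_eq_jumpOp]
  exact JumpProcess.exists_fellerSemigroup (FellerZW.jumpRate_nonneg hadm)
    FellerZW.finite_jumpTarget_eq hC
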